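/- **Definitions.** A *triangulation* $T$ (of a square) is a finite oriented simplicial complex homeomorphic to a closed disk with exactly four vertices on its boundary; these are the *corners* $\mathbf p,\mathbf q,\mathbf r,\mathbf s$, labelled in the cyclic order given by the orientation. The other vertices are *interior vertices*. A *drawing* of $T$ is a map $\rho$ from the vertices of $T$ to $\mathbb C^2$ with $\rho(\mathbf p)+\rho(\mathbf r)=\rho(\mathbf q)+\rho(\mathbf s)$. A triangle of $T$ is *nondegenerate* for $\rho$ if $\rho$ maps its vertices to three non-collinear points of $\mathbb C^2$. The *area* of a triangle with vertices $a,b,c$ (in the order given by the orientation of $T$), drawn at $(x_1,y_1),(x_2,y_2),(x_3,y_3)$, is $$\tfrac12\det\begin{pmatrix}1&1&1\\x_1&x_2&x_3\\y_1&y_2&y_3\end{pmatrix}\in\mathbb C .$$ A *subdivision* of $T$ is a set of three vertices that are pairwise joined by edges but are not the vertices of a triangle of $T$; it *contains* a triangle $\Delta$ if $\Delta$ lies inside the corresponding 3-cycle $C$, that is, if after attaching a square $Q$ to $T$ along its boundary (which gives a sphere), $\Delta$ is not in the component of the complement of $C$ that contains the interior of $Q$. An interior (i.e. non-boundary) edge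 $xy$, lying in the triangles $xyz$ and $xyz'$, *can be contracted* if the complex obtained by deleting these two triangles and identifying $x$ with $y$, $zx$ with $zy$ and $z'x$ with $z'y$ is simplicial. A drawing $\rho$ of $T$ is *simple* if (i) every subdivision of $T$ contains at least one nondegenerate triangle of $\rho$; (ii) no interior edge $vw$ with $\rho(v)=\rho(w)$ can be contracted; (iii) every interior vertex belongs to at least one nondegenerate triangle of $\rho$. Drawings $\rho$ of $T$ and $\rho'$ of $T'$ *have the same nondegenerate triangles* if there is a map $f$ from the vertices of $T$ to those of $T'$ that induces a bijection from the nondegenerate triangles of $\rho$ to those of $\rho'$, preserves their orientations, and satisfies $\rho'(f(v))=\rho(v)$ for every vertex $v$ of a nondegenerate triangle of $\rho$. **Theorem.** (a) Let $T$ be a triangulation and let $\rho$ be a drawing of $T$ with $l>0$ nondegenerate triangles. Suppose that no nonempty set of nondegenerate triangles of $\rho$ has areas summing to $0$. Then there are a triangulation $T'$ and a simple drawing $\rho'$ of $T'$ such that $\rho$ and $\rho'$ have the same nondegenerate triangles. (b) Let $T$ be a triangulation and let $\rho$ be a simple drawing of $T$ with $l>0$ nondegenerate triangles. Suppose that no nonempty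 set of nondegenerate triangles of $\rho$ has areas summing to $0$. Then $T$ has at most $\frac32 l-2$ interior vertices and at most $3l-2$ triangles. In particular this holds for every $T'$, $\rho'$ as in (a). -/

import Mathlib

universe u

namespace SquareDrawing

/-! ### Combinatorial disks -/

section Complex

variable {V : Type u} [Fintype V] [DecidableEq V]

/-- The triangles (two-dimensional faces) of a complex. -/
noncomputable def triangles (K : AbstractSimplicialComplex V) : Finset (Finset V) :=
  open Classical in Finset.univ.filter fun t => t ∈ K.faces ∧ t.card = 3

/-- `e` is an edge (one-dimensional face) of the complex. -/
def IsEdge (K : AbstractSimplicialComplex V) (e : Finset V) : Prop :=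
  e ∈ K.faces ∧ e.card = 2

/-- The triangles of the complex that contain a given set of vertices. -/
noncomputable def trianglesAt (K : AbstractSimplicialComplex V) (e : Finset V) :
    Finset (Finset V) :=
  (triangles K).filter fun t => e ⊆ t

/-- A boundary edge is an edge of exactly one triangle. -/
def IsBoundaryEdge (K : AbstractSimplicialComplex V) (e : Finset V) : Prop :=
  IsEdge K e ∧ (trianglesAt K e).card = 1

/-- An interior edge is an edge that is not on the boundary. -/
def IsInteriorEdge (K : AbstractSimplicialComplex V) (e : Finset V) : Prop :=
  IsEdge K e ∧ ¬ IsBoundaryEdge K e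

/-- The graph formed by the vertices and edges of the complex. -/
def oneSkeleton (K : AbstractSimplicialComplex V) : SimpleGraph V where
  Adj a b := a ≠ b ∧ {a, b} ∈ K.faces
  symm := ⟨fun a b h => ⟨h.1.symm, by rw [Finset.pair_comm]; exact h.2⟩⟩
  loopless := ⟨fun _ h => h.1 rfl⟩

/-- The link of the vertex `v` in a two-dimensional complex, as a graph: its vertices are the
neighbours of `v`, and `a`, `b` are joined if `v`, `a`, `b` span a triangle. -/
def linkGraph (K : AbstractSimplicialComplex V) (v : V) :
    SimpleGraph {a : V // (oneSkeleton K).Adj v a} where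
  Adj a b := a ≠ b ∧ {v, a.1, b.1} ∈ K.faces
  symm := ⟨fun a b h => ⟨h.1.symm, by rw [Finset.pair_comm]; exact h.2⟩⟩
  loopless := ⟨fun _ h => h.1 rfl⟩

/-- An edge path: any two consecutive vertices are equal or joined by an edge. -/
def IsEdgePath (K : AbstractSimplicialComplex V) (l : List V) : Prop :=
  l.IsChain fun a b => {a, b} ∈ K.faces

/-- The elementary homotopy of edge paths: a passage `a, b, c` is replaced by `a, c`, where
`a`, `b`, `c` (not necessarily distinct) are the vertices of a face. -/
def ElementaryHomotopy (K : AbstractSimplicialComplex V) (l l' : List V) : Prop :=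
  ∃ (x y : List V) (a b c : V), {a, b, c} ∈ K.faces ∧
    l = x ++ [a, b, c] ++ y ∧ l' = x ++ [a, c] ++ y

/-- `K` is a triangulated closed disk: a connected and simply connected compact surface with
non-empty boundary. The first four fields say that `K` is a surface with boundary: it is purely
two-dimensional, each edge is in at most two triangles, and vertex links are connected (so that
each link is a path or a cycle). Simple connectivity is triviality of the edge-path group. -/
structure IsDisk (K : AbstractSimplicialComplex V) : Prop where
  card_le : ∀ s ∈ K.faces, s.card ≤ 3
  pure : ∀ s ∈ K.faces, ∃ t ∈ triangles K, s ⊆ t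
  edge_card_le : ∀ e, IsEdge K e → (trianglesAt K e).card ≤ 2
  link_connected : ∀ v, (linkGraph K v).Connected
  connected : (oneSkeleton K).Connected
  simply_connected : ∀ (v : V) (l : List V), IsEdgePath K (v :: l ++ [v]) →
    Relation.EqvGen (ElementaryHomotopy K) (v :: l ++ [v]) [v, v]
  boundary_nonempty : ∃ e, IsBoundaryEdge K e

end Complex

/-! ### Triangulations of a square -/

/-- A triangulation of a square with vertex set `V`: an oriented simplicial complex which is a
disk with four vertices on the boundary. The relation `pos a b c` says that `a`, `b`, `c` are the
vertices of a triangle, listed in the cyclic order given by the orientation. The corners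
`𝐩, 𝐪, 𝐫, 𝐬` are `corner 0, corner 1, corner 2, corner 3`. -/
structure Triangulation (V : Type u) [Fintype V] [DecidableEq V] extends
    AbstractSimplicialComplex V where
  isDisk : IsDisk toAbstractSimplicialComplex
  pos : V → V → V → Prop
  /-- Only the vertices of a triangle are ordered, -/
  pos_triangle : ∀ a b c, pos a b c → {a, b, c} ∈ triangles toAbstractSimplicialComplex
  /-- the order is cyclic, -/
  pos_rotate : ∀ a b c, pos a b c → pos b c a
  /-- each triangle has one of its two cyclic orders, -/
  pos_xor : ∀ a b c, {a, b, c} ∈ triangles toAbstractSimplicialComplex →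
    Xor (pos a b c) (pos b a c)
  /-- and two triangles induce opposite directions on a common edge. -/
  pos_coherent : ∀ a b c d, pos a b c → pos a b d → c = d
  corner : Fin 4 → V
  corner_injective : Function.Injective corner
  /-- The boundary is the quadrilateral formed by the corners. -/
  boundary_iff : ∀ e, IsBoundaryEdge toAbstractSimplicialComplex e ↔
    ∃ i, e = {corner i, corner (i + 1)}
  /-- The corners are numbered in the direction that the orientation induces on the boundary. -/
  corner_pos : ∀ i, ∃ c, pos (corner i) (corner (i + 1)) c

namespace Triangulation

variable {V : Type u} [Fintype V] [DecidableEq V]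

/-- The underlying simplicial complex. -/
abbrev cx (T : Triangulation V) : AbstractSimplicialComplex V := T.toAbstractSimplicialComplex

/-- The interior vertices: those that are not corners. -/
noncomputable def interiorVertices (T : Triangulation V) : Finset V :=
  open Classical in Finset.univ.filter fun v => ∀ i, v ≠ T.corner i

/-- A subdivision: three vertices, joined pairwise by edges, that do not span a triangle. -/
def IsSubdivision (T : Triangulation V) (S : Finset V) : Prop :=
  S.card = 3 ∧ (∀ e ⊆ S, e.card = 2 → IsEdge T.cx e) ∧ S ∉ triangles T.cx

/-- Two triangles share an edge which is not an edge of the 3-cycle with vertex set `S`. -/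
def CrossAdj (T : Triangulation V) (S t t' : Finset V) : Prop :=
  t ∈ triangles T.cx ∧ t' ∈ triangles T.cx ∧
    ∃ e, IsEdge T.cx e ∧ e ⊆ t ∧ e ⊆ t' ∧ ¬ e ⊆ S

/-- Attach a square `Q` to `T` along its boundary, which gives a sphere. The triangle `t` is
outside the 3-cycle with vertex set `S` if it lies in the same component of the complement of
the cycle as `Q`: one gets from `t` to `Q` by crossing edges that are not on the cycle. -/
def IsOutside (T : Triangulation V) (S t : Finset V) : Prop :=
  ∃ t', Relation.ReflTransGen (T.CrossAdj S) t t' ∧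
    ∃ e, IsBoundaryEdge T.cx e ∧ e ⊆ t' ∧ ¬ e ⊆ S

/-- The triangle `t` is contained in (lies inside) the 3-cycle with vertex set `S`. -/
def IsInside (T : Triangulation V) (S t : Finset V) : Prop :=
  t ∈ triangles T.cx ∧ ¬ T.IsOutside S t

/-- The identifications of faces made when the edge `xy` is contracted: `x` with `y`, and `zx`
with `zy` for each triangle `xyz`. -/
inductive Identified (T : Triangulation V) (x y : V) : Finset V → Finset V → Prop
  | vertex : Identified T x y {x} {y}
  | edge (z : V) : {x, y, z} ∈ triangles T.cx → Identified T x y {z, x} {z, y}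

/-- The edge `xy` can be contracted. The cells of the contracted complex are the faces of `T`
other than `xy` and the triangles containing it, up to the above identifications; its vertices
are those of `T`, with `y` renamed `x`. This complex is simplicial if different cells have
different vertex sets. -/
def CanContract (T : Triangulation V) (x y : V) : Prop :=
  ∀ s ∈ T.cx.faces, ∀ s' ∈ T.cx.faces, ¬ {x, y} ⊆ s → ¬ {x, y} ⊆ s' →
    s.image (fun v => if v = y then x else v) = s'.image (fun v => if v = y then x else v) →
    s = s' ∨ T.Identified x y s s' ∨ T.Identified x y s' s

end Triangulation

/-! ### Drawings -/

/-- The signed area of an ordered triangle in the complex plane `ℂ²`. -/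
noncomputable def triArea (P Q R : Fin 2 → ℂ) : ℂ :=
  1 / 2 * Matrix.det !![1, 1, 1; P 0, Q 0, R 0; P 1, Q 1, R 1]

/-- A drawing: a map of the vertices to `ℂ²` that sends the corners to the vertices of a
(possibly degenerate) parallelogram. -/
structure Drawing {V : Type u} [Fintype V] [DecidableEq V] (T : Triangulation V) where
  toFun : V → Fin 2 → ℂ
  parallelogram : toFun (T.corner 0) + toFun (T.corner 2) =
    toFun (T.corner 1) + toFun (T.corner 3)

namespace Drawing

variable {V : Type u} [Fintype V] [DecidableEq V] {T : Triangulation V}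

/-- The nondegenerate triangles: those whose vertices are drawn at non-collinear points. -/
noncomputable def nondegenerate (ρ : Drawing T) : Finset (Finset V) :=
  open Classical in
    (triangles T.cx).filter fun t => ¬ Collinear ℂ (ρ.toFun '' (t : Set V))

/-- The area of a triangle of `T` in the drawing, its vertices being ordered according to the
orientation of `T` (by `area_eq` below, the choice of the first vertex does not matter). -/
noncomputable def area (ρ : Drawing T) (t : Finset V) : ℂ :=
  open Classical in
    if h : ∃ x : V × V × V, T.pos x.1 x.2.1 x.2.2 ∧ t = {x.1, x.2.1, x.2.2} then
      triArea (ρ.toFun h.choose.1) (ρ.toFun h.choose.2.1) (ρ.toFun h.choose.2.2)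
    else 0

/-- No non-empty set of nondegenerate triangles has areas summing to zero. -/
def NoZeroSum (ρ : Drawing T) : Prop :=
  ∀ S ⊆ ρ.nondegenerate, S.Nonempty → ∑ t ∈ S, ρ.area t ≠ 0

/-- A simple drawing. An edge `vw` is elastic if `v` and `w` are drawn at the same point. -/
structure IsSimple (ρ : Drawing T) : Prop where
  subdivision : ∀ S, T.IsSubdivision S → ∃ t ∈ ρ.nondegenerate, T.IsInside S t
  elastic : ¬ ∃ v w, IsInteriorEdge T.cx {v, w} ∧ ρ.toFun v = ρ.toFun w ∧ T.CanContract v w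
  interior : ∀ v ∈ T.interiorVertices, ∃ t ∈ ρ.nondegenerate, v ∈ t

/-- The drawings `ρ` and `ρ'` (of possibly different triangulations) have the same nondegenerate
triangles: a map `f` of vertices matches them bijectively, and matched triangles have the same
vertices in `ℂ²` and the same orientation. -/
def SameNondegenerate {V' : Type u} [Fintype V'] [DecidableEq V'] {T' : Triangulation V'}
    (ρ : Drawing T) (ρ' : Drawing T') : Prop :=
  ∃ f : V → V',
    Set.BijOn (fun t => t.image f) (ρ.nondegenerate : Set (Finset V))
      (ρ'.nondegenerate : Set (Finset V')) ∧
    (∀ t ∈ ρ.nondegenerate, ∀ v ∈ t, ρ'.toFun (f v) = ρ.toFun v) ∧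
    ∀ a b c, T.pos a b c → {a, b, c} ∈ ρ.nondegenerate → T'.pos (f a) (f b) (f c)

theorem triArea_rotate (P Q R : Fin 2 → ℂ) : triArea Q R P = triArea P Q R := by
  simp [triArea, Matrix.det_fin_three]
  ring

theorem area_eq (ρ : Drawing T) {a b c : V} (h : T.pos a b c) :
    ρ.area {a, b, c} = triArea (ρ.toFun a) (ρ.toFun b) (ρ.toFun c) := by
  have hex : ∃ x : V × V × V, T.pos x.1 x.2.1 x.2.2 ∧
      ({a, b, c} : Finset V) = {x.1, x.2.1, x.2.2} := ⟨(a, b, c), h, rfl⟩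
  have hne : ∀ x y z, T.pos x y z → ¬ T.pos y x z := fun x y z h1 h2 => by
    rcases T.pos_xor _ _ _ (T.pos_triangle _ _ _ h1) with h3 | h3
    · exact h3.2 h2
    · exact h3.2 h1
  have hd : ∀ x y z, T.pos x y z → x ≠ y := fun x y z h1 h2 => by
    subst h2
    exact hne _ _ _ h1 h1
  rw [area, dif_pos hex]
  obtain ⟨hp, he⟩ := hex.choose_spec
  generalize hex.choose = w at hp he
  obtain ⟨x, y, z⟩ := w
  change T.pos x y z at hp
  change triArea (ρ.toFun x) (ρ.toFun y) (ρ.toFun z) = _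
  have hx : x ∈ ({a, b, c} : Finset V) := by rw [he]; simp
  have hy : y ∈ ({a, b, c} : Finset V) := by rw [he]; simp
  have hz : z ∈ ({a, b, c} : Finset V) := by rw [he]; simp
  clear he hex
  have hp1 := T.pos_rotate _ _ _ hp
  have hp2 := T.pos_rotate _ _ _ hp1
  have h1 := hd _ _ _ hp
  have h2 := hd _ _ _ hp1
  have h3 := hd _ _ _ hp2
  have n0 := hne _ _ _ h
  simp only [Finset.mem_insert, Finset.mem_singleton] at hx hy hz
  rcases hx with hx | hx | hx <;> rcases hy with hy | hy | hy <;>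
    rcases hz with hz | hz | hz <;> rw [hx, hy] at h1 <;> rw [hy, hz] at h2 <;>
    rw [hz, hx] at h3 <;> rw [hx, hy, hz] at hp hp1 hp2 ⊢ <;>
    first
    | exact absurd rfl h1
    | exact absurd rfl h2
    | exact absurd rfl h3
    | exact absurd hp n0
    | exact absurd hp1 n0
    | exact absurd hp2 n0
    | exact triArea_rotate _ _ _
    | exact (triArea_rotate _ _ _).symm

end Drawing

end SquareDrawing

/-!
Degenerate triangles have area zero, so under the hypothesis on areas a region of `T` whose total
area vanishes contains no nondegenerate triangle. Two regions of this kind matter. The total area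
of `T` is that of the parallelogram of the corners, so this parallelogram is not degenerate; and the
inside of a 3-cycle two of whose vertices are drawn at the same point has area zero.

For (a), an edge drawn as a point is removed by contracting it. If it cannot be contracted, it lies
on a 3-cycle that bounds no triangle. A vertex inside a 3-cycle without nondegenerate triangles, or
any interior vertex without nondegenerate triangles, has all its neighbours on a line and can be
moved onto one of them. The new edge is contracted, or else it lies on a 3-cycle with a smaller
inside, so that a drawing that is not simple always admits one with fewer vertices.

For (b), no edge of a simple drawing is drawn as a point. Hence going around an interior vertex one
meets at least two nondegenerate triangles, and at each corner at least one, so that twice the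
number of interior vertices plus four is at most `3 * l`. The number of triangles then comes from
Euler's formula. The topology of the disk enters only through chains with coefficients in
`ZMod 2`: edge paths being contractible, every cycle of edges bounds, and since the boundary is
nonempty, no nonzero chain of triangles is a cycle.
-/

namespace SquareDrawing

/-! ### Disks and orientations -/

section Complex

variable {V : Type u} {K : AbstractSimplicialComplex V}

theorem mem_faces_of_subset {s t : Finset V} (ht : t ∈ K.faces) (hs : s ⊆ t) (hn : s.Nonempty) :
    s ∈ K.faces :=
  (K.isRelLowerSet_faces ht).2 hs hn

theorem isEdge_pair_iff [DecidableEq V] {a b : V} : IsEdge K {a, b} ↔ (oneSkeleton K).Adj a b := by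
  refine ⟨fun h => ⟨?_, h.1⟩, fun h => ⟨h.2, Finset.card_pair h.1⟩⟩
  rintro rfl
  simpa using h.2

variable [Fintype V]

theorem mem_triangles {t : Finset V} : t ∈ triangles K ↔ t ∈ K.faces ∧ t.card = 3 := by
  simp [triangles]

theorem isEdge_of_subset {e t : Finset V} (ht : t ∈ triangles K) (he : e ⊆ t) (hc : e.card = 2) :
    IsEdge K e :=
  ⟨mem_faces_of_subset (mem_triangles.1 ht).1 he (Finset.card_pos.1 (by omega)), hc⟩

variable [DecidableEq V]

theorem mem_trianglesAt {e t : Finset V} : t ∈ trianglesAt K e ↔ t ∈ triangles K ∧ e ⊆ t := by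
  simp [trianglesAt]

end Complex

namespace IsDisk

variable {V : Type u} [Fintype V] [DecidableEq V] {K : AbstractSimplicialComplex V}

theorem exists_adj (hK : IsDisk K) (v : V) : ∃ a, (oneSkeleton K).Adj v a :=
  let ⟨a⟩ := (hK.link_connected v).nonempty
  ⟨a.1, a.2⟩

theorem link_induction (hK : IsDisk K) {v : V} {P : V → Prop} {a₀ : V}
    (h₀ : (oneSkeleton K).Adj v a₀) (hP : P a₀)
    (step : ∀ a b, {v, a, b} ∈ triangles K → P a → P b) {a : V} (ha : (oneSkeleton K).Adj v a) :
    P a := by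
  have hreach := (hK.link_connected v).preconnected ⟨a₀, h₀⟩ ⟨a, ha⟩
  rw [SimpleGraph.reachable_iff_reflTransGen] at hreach
  suffices h : ∀ x, Relation.ReflTransGen (linkGraph K v).Adj ⟨a₀, h₀⟩ x → P x.1 from h _ hreach
  intro x hx
  induction hx with
  | refl => exact hP
  | @tail x y _ hxy ih =>
    have hne : x.1 ≠ y.1 := fun e => hxy.1 (Subtype.ext e)
    have hcard : ({v, x.1, y.1} : Finset V).card = 3 :=
      Finset.card_eq_three.2 ⟨_, _, _, x.2.1, y.2.1, hne, rfl⟩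
    exact step _ _ (mem_triangles.2 ⟨hxy.2, hcard⟩) ih

theorem connected_induction (hK : IsDisk K) {P : V → Prop} {a₀ : V} (h₀ : P a₀)
    (step : ∀ a b, (oneSkeleton K).Adj a b → P a → P b) (a : V) : P a := by
  have hreach := hK.connected.preconnected a₀ a
  rw [SimpleGraph.reachable_iff_reflTransGen] at hreach
  induction hreach with
  | refl => exact h₀
  | tail _ hab ih => exact step _ _ hab ih

theorem exists_triangle_of_adj (hK : IsDisk K) {a b : V} (h : (oneSkeleton K).Adj a b) :
    ∃ t ∈ triangles K, {a, b} ⊆ t :=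
  hK.pure _ h.2

theorem star_induction (hK : IsDisk K) {v : V} {P : Finset V → Prop} {t₀ : Finset V}
    (ht₀ : t₀ ∈ triangles K) (hv₀ : v ∈ t₀) (hP : P t₀)
    (step : ∀ t t' a, t ∈ triangles K → t' ∈ triangles K → a ≠ v → {v, a} ⊆ t → {v, a} ⊆ t' →
      P t → P t') {t : Finset V} (ht : t ∈ triangles K) (hv : v ∈ t) : P t := by
  have exists_adj_mem : ∀ t ∈ triangles K, v ∈ t → ∃ a, (oneSkeleton K).Adj v a ∧ a ∈ t := by
    intro t ht hv
    obtain ⟨a, ha, hav⟩ := t.exists_mem_ne (by rw [(mem_triangles.1 ht).2]; omega) v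
    exact ⟨a, isEdge_pair_iff.1 (isEdge_of_subset ht (by grind) (Finset.card_pair hav.symm)), ha⟩
  obtain ⟨a₀, h₀, ha₀⟩ := exists_adj_mem t₀ ht₀ hv₀
  obtain ⟨a, h, ha⟩ := exists_adj_mem t ht hv
  have spread := hK.link_induction (P := fun a => ∀ t ∈ triangles K, {v, a} ⊆ t → P t) h₀
    (fun t ht hs => step _ _ a₀ ht₀ ht h₀.1.symm (by grind) hs hP)
    (fun a b hab H t ht hs => ?_) h
  · exact spread t ht (by grind)
  · have hbv : b ≠ v := by
      have := (mem_triangles.1 hab).2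
      rintro rfl
      have := Finset.card_le_two (a := b) (b := a)
      grind
    exact step _ _ b hab ht hbv (by grind) hs (H _ hab (by grind))

theorem triangle_induction (hK : IsDisk K) {P : Finset V → Prop} {t₀ : Finset V}
    (ht₀ : t₀ ∈ triangles K) (hP : P t₀)
    (step : ∀ t t' e, t ∈ triangles K → t' ∈ triangles K → IsEdge K e → e ⊆ t → e ⊆ t' →
      P t → P t') {t : Finset V} (ht : t ∈ triangles K) : P t := by
  have star : ∀ v t₀, t₀ ∈ triangles K → v ∈ t₀ → P t₀ → ∀ t ∈ triangles K, v ∈ t → P t :=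
    fun v t₀ ht₀ hv₀ hP t ht hv => hK.star_induction ht₀ hv₀ hP (fun t t' a h h' ha hs hs' =>
      step t t' {v, a} h h' (isEdge_of_subset h hs (Finset.card_pair ha.symm)) hs hs') ht hv
  have nonempty : ∀ t ∈ triangles K, t.Nonempty := fun t ht =>
    Finset.card_pos.1 (by rw [(mem_triangles.1 ht).2]; omega)
  obtain ⟨v₀, hv₀⟩ := nonempty t₀ ht₀
  obtain ⟨v, hv⟩ := nonempty t ht
  refine hK.connected_induction (P := fun v => ∀ t ∈ triangles K, v ∈ t → P t)
    (star v₀ t₀ ht₀ hv₀ hP) (fun x y hxy H => ?_) v t ht hv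
  obtain ⟨t, ht, hs⟩ := hK.exists_triangle_of_adj hxy
  exact star y t ht (hs (by simp)) (H t ht (hs (by simp)))

/-- The edge is free in the sense that the subcomplex `I` can be collapsed through it: a disk
contains no closed surface. -/
theorem exists_free_edge (hK : IsDisk K) {I : Set (Finset V)} (hI : I ⊆ triangles K)
    (hne : I.Nonempty) :
    ∃ t ∈ I, ∃ e ⊆ t, e.card = 2 ∧ ∀ t' ∈ I, e ⊆ t' → t' = t := by
  by_contra! closed
  obtain ⟨t₀, ht₀⟩ := hne
  have all_mem : ∀ t ∈ triangles K, t ∈ I := fun t ht => by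
    refine hK.triangle_induction (P := (· ∈ I)) (hI ht₀) ht₀ ?_ ht
    intro t t' e ht ht' he hs hs' hP
    obtain ⟨t'', h1, h2, h3⟩ := closed t hP e hs he.2
    by_contra hn
    have hsub : {t, t', t''} ⊆ trianglesAt K e := by
      simp only [Finset.insert_subset_iff, Finset.singleton_subset_iff, mem_trianglesAt]
      exact ⟨⟨ht, hs⟩, ⟨ht', hs'⟩, hI h1, h2⟩
    have hcard := (Finset.card_le_card hsub).trans (hK.edge_card_le e he)
    rw [Finset.card_eq_three.2 ⟨t, t', t'', fun e => hn (e ▸ hP), h3.symm,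
      fun e => hn (e ▸ h1), rfl⟩] at hcard
    omega
  obtain ⟨e, he, hc⟩ := hK.boundary_nonempty
  obtain ⟨t, ht⟩ := Finset.card_eq_one.1 hc
  obtain ⟨htK, het⟩ := mem_trianglesAt.1 (ht ▸ Finset.mem_singleton_self t)
  obtain ⟨t', h1, h2, h3⟩ := closed t (all_mem t htK) e het he.2
  have : t' ∈ trianglesAt K e := mem_trianglesAt.2 ⟨hI h1, h2⟩
  rw [ht, Finset.mem_singleton] at this
  exact h3 this

end IsDisk

/-- A coherent orientation of a complex: `pos a b c` says that `a`, `b`, `c` are the vertices of a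
triangle in their cyclic order. These are the axioms of `Triangulation.pos`, separated from the
disk so that they can be checked on a complex before it is known to be one. -/
structure IsOrientation {V : Type u} [Fintype V] [DecidableEq V] (K : AbstractSimplicialComplex V)
    (pos : V → V → V → Prop) : Prop where
  mem_triangles : ∀ {a b c}, pos a b c → {a, b, c} ∈ triangles K
  rotate : ∀ {a b c}, pos a b c → pos b c a
  xor : ∀ {a b c}, {a, b, c} ∈ triangles K → Xor (pos a b c) (pos b a c)
  coherent : ∀ {a b c d}, pos a b c → pos a b d → c = d

/-- `a`, `b` is a directed edge of the oriented boundary of some triangle. -/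
def IsDart {V : Type u} (pos : V → V → V → Prop) (a b : V) : Prop := ∃ c, pos a b c

namespace IsOrientation

variable {V : Type u} [Fintype V] [DecidableEq V] {K : AbstractSimplicialComplex V}
  {pos : V → V → V → Prop} (o : IsOrientation K pos) {a b c : V}

include o

theorem asymm (h : pos a b c) : ¬ pos b a c := fun h' =>
  (o.xor (o.mem_triangles h)).elim (fun h => h.2 h') fun h'' => h''.2 h

theorem pos_or_pos (h : {a, b, c} ∈ triangles K) : pos a b c ∨ pos b a c :=
  (o.xor h).imp And.left And.left

theorem rotate_right (h : pos a b c) : pos c a b := o.rotate (o.rotate h)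

theorem ne_left (h : pos a b c) : a ≠ b := by
  rintro rfl
  exact o.asymm h h

theorem ne_right (h : pos a b c) : b ≠ c := o.ne_left (o.rotate h)

theorem ne_outer (h : pos a b c) : a ≠ c := (o.ne_left (o.rotate_right h)).symm

theorem coherent_left {a' : V} (h : pos b a c) (h' : pos b a' c) : a = a' :=
  o.coherent (o.rotate_right h) (o.rotate_right h')

theorem exists_pos {t : Finset V} (ht : t ∈ triangles K) : ∃ a b c, pos a b c ∧ t = {a, b, c} := by
  obtain ⟨a, b, c, -, -, -, rfl⟩ := Finset.card_eq_three.1 (SquareDrawing.mem_triangles.1 ht).2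
  rcases o.pos_or_pos ht with h | h
  · exact ⟨a, b, c, h, rfl⟩
  · exact ⟨b, a, c, h, Finset.insert_comm _ _ _⟩

theorem exists_pos_of_mem {t : Finset V} (ht : t ∈ triangles K) (ha : a ∈ t) :
    ∃ b c, pos a b c ∧ t = {a, b, c} := by
  obtain ⟨x, y, z, h, rfl⟩ := o.exists_pos ht
  simp only [Finset.mem_insert, Finset.mem_singleton] at ha
  rcases ha with rfl | rfl | rfl
  · exact ⟨y, z, h, rfl⟩
  · exact ⟨z, x, o.rotate h, by grind⟩
  · exact ⟨x, y, o.rotate_right h, by grind⟩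

theorem exists_pos_of_pair {t : Finset V} (ht : t ∈ triangles K) (hab : a ≠ b) (ha : a ∈ t)
    (hb : b ∈ t) : ∃ c, (pos a b c ∨ pos b a c) ∧ t = {a, b, c} := by
  obtain ⟨y, z, h, rfl⟩ := o.exists_pos_of_mem ht ha
  simp only [Finset.mem_insert, Finset.mem_singleton] at hb
  rcases hb with rfl | rfl | rfl
  · exact absurd rfl hab
  · exact ⟨z, Or.inl h, rfl⟩
  · exact ⟨y, Or.inr (o.rotate_right h), by grind⟩

theorem adj_left (h : pos a b c) : (oneSkeleton K).Adj a b :=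
  isEdge_pair_iff.1 <|
    isEdge_of_subset (o.mem_triangles h) (by grind) (Finset.card_pair (o.ne_left h))

theorem adj_outer (h : pos a b c) : (oneSkeleton K).Adj a c := (o.adj_left (o.rotate_right h)).symm

theorem adj_of_isDart (h : IsDart pos a b) : (oneSkeleton K).Adj a b := o.adj_left h.choose_spec

theorem isDart_or_isDart {t : Finset V} (ht : t ∈ trianglesAt K {a, b}) (hab : a ≠ b) :
    IsDart pos a b ∨ IsDart pos b a := by
  obtain ⟨ht, hs⟩ := mem_trianglesAt.1 ht
  obtain ⟨c, hc, -⟩ := o.exists_pos_of_pair ht hab (hs (by simp)) (hs (by simp))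
  exact hc.imp (⟨c, ·⟩) (⟨c, ·⟩)

open Classical in
theorem card_filter_pos (a b : V) :
    (Finset.univ.filter (pos a b)).card = if IsDart pos a b then 1 else 0 := by
  split_ifs with h
  · obtain ⟨c, hc⟩ := h
    refine Finset.card_eq_one.2 ⟨c, Finset.ext fun d => ?_⟩
    simp only [Finset.mem_filter, Finset.mem_univ, true_and, Finset.mem_singleton]
    exact ⟨fun hd => o.coherent hd hc, fun hd => hd ▸ hc⟩
  · rw [Finset.card_eq_zero, Finset.filter_eq_empty_iff]
    exact fun c _ hc => h ⟨c, hc⟩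

open Classical in
theorem card_trianglesAt_pair (hab : a ≠ b) :
    (trianglesAt K {a, b}).card =
      (if IsDart pos a b then 1 else 0) + (if IsDart pos b a then 1 else 0) := by
  have hdisj : Disjoint (Finset.univ.filter (pos a b)) (Finset.univ.filter (pos b a)) :=
    Finset.disjoint_filter.2 fun c _ hc hc' => o.asymm hc hc'
  rw [← o.card_filter_pos, ← o.card_filter_pos, ← Finset.card_union_of_disjoint hdisj,
    ← Finset.filter_or]
  refine (Finset.card_nbij (fun c => {a, b, c}) (fun c hc => ?_) ?_ fun t ht => ?_).symm
  · rw [Finset.mem_coe, mem_trianglesAt]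
    refine ⟨?_, by grind⟩
    rcases (Finset.mem_filter.1 hc).2 with hc | hc
    · exact o.mem_triangles hc
    · exact (Finset.insert_comm b a {c}).subst (motive := (· ∈ triangles K)) (o.mem_triangles hc)
  · have ne : ∀ c, pos a b c ∨ pos b a c → a ≠ c ∧ b ≠ c := fun c hc =>
      hc.elim (fun hc => ⟨o.ne_outer hc, o.ne_right hc⟩) fun hc => ⟨o.ne_right hc, o.ne_outer hc⟩
    intro c hc d _ (hcd : ({a, b, c} : Finset V) = {a, b, d})
    have := ne c (Finset.mem_filter.1 hc).2
    have : c ∈ ({a, b, d} : Finset V) := hcd ▸ by simp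
    grind
  · obtain ⟨ht, hs⟩ := mem_trianglesAt.1 ht
    obtain ⟨c, hc, rfl⟩ := o.exists_pos_of_pair ht hab (hs (by simp)) (hs (by simp))
    exact ⟨c, by simpa using hc, rfl⟩

theorem isBoundaryEdge_iff :
    IsBoundaryEdge K {a, b} ↔ Xor (IsDart pos a b) (IsDart pos b a) := by
  have key (hab : a ≠ b) :
      (trianglesAt K {a, b}).card = 1 ↔ Xor (IsDart pos a b) (IsDart pos b a) := by
    classical
    rw [o.card_trianglesAt_pair hab]
    by_cases h : IsDart pos a b <;> by_cases h' : IsDart pos b a <;> simp [h, h']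
  refine ⟨fun h => (key (isEdge_pair_iff.1 h.1).1).1 h.2, fun h => ?_⟩
  have hadj : (oneSkeleton K).Adj a b :=
    h.elim (fun h => o.adj_of_isDart h.1) fun h => (o.adj_of_isDart h.1).symm
  exact ⟨isEdge_pair_iff.2 hadj, (key hadj.1).2 h⟩

end IsOrientation

namespace Triangulation

variable {V : Type u} [Fintype V] [DecidableEq V] {T : Triangulation V} {a b v : V}

theorem isOrientation (T : Triangulation V) : IsOrientation T.cx T.pos where
  mem_triangles := T.pos_triangle _ _ _
  rotate := T.pos_rotate _ _ _
  xor := T.pos_xor _ _ _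
  coherent := T.pos_coherent _ _ _ _

theorem adj_iff : (oneSkeleton T.cx).Adj a b ↔ IsDart T.pos a b ∨ IsDart T.pos b a := by
  refine ⟨fun h => ?_, fun h => h.elim T.isOrientation.adj_of_isDart fun h =>
    (T.isOrientation.adj_of_isDart h).symm⟩
  obtain ⟨t, ht, hs⟩ := T.isDisk.exists_triangle_of_adj h
  exact T.isOrientation.isDart_or_isDart (mem_trianglesAt.2 ⟨ht, hs⟩) h.1

theorem isInteriorEdge_iff :
    IsInteriorEdge T.cx {a, b} ↔ IsDart T.pos a b ∧ IsDart T.pos b a := by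
  rw [IsInteriorEdge, isEdge_pair_iff, adj_iff, T.isOrientation.isBoundaryEdge_iff]
  grind [Xor]

theorem not_isDart_corner (i : Fin 4) : ¬ IsDart T.pos (T.corner (i + 1)) (T.corner i) := by
  have h := T.isOrientation.isBoundaryEdge_iff.1 ((T.boundary_iff _).2 ⟨i, rfl⟩)
  exact h.elim (fun h => h.2) fun h => absurd (T.corner_pos i) h.2

theorem exists_corner_of_isDart (h : IsDart T.pos a b) (h' : ¬ IsDart T.pos b a) :
    ∃ i, a = T.corner i ∧ b = T.corner (i + 1) := by
  obtain ⟨i, hi⟩ := (T.boundary_iff _).1 (T.isOrientation.isBoundaryEdge_iff.2 (.inl ⟨h, h'⟩))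
  have hne := (T.isOrientation.adj_of_isDart h).1
  have ha : a ∈ ({T.corner i, T.corner (i + 1)} : Finset V) := hi ▸ by simp
  have hb : b ∈ ({T.corner i, T.corner (i + 1)} : Finset V) := hi ▸ by simp
  simp only [Finset.mem_insert, Finset.mem_singleton] at ha hb
  rcases ha with ha | ha <;> rcases hb with hb | hb
  · exact absurd (ha.trans hb.symm) hne
  · exact ⟨i, ha, hb⟩
  · subst ha hb
    exact absurd (T.corner_pos i) h'
  · exact absurd (ha.trans hb.symm) hne

theorem isDart_and_isDart_of_adj (h : (oneSkeleton T.cx).Adj a b) (ha : ∀ i, a ≠ T.corner i) :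
    IsDart T.pos a b ∧ IsDart T.pos b a := by
  refine ⟨?_, ?_⟩ <;> by_contra hn
  · obtain ⟨i, -, hi⟩ := exists_corner_of_isDart ((adj_iff.1 h).resolve_left hn) hn
    exact ha _ hi
  · obtain ⟨i, hi, -⟩ := exists_corner_of_isDart ((adj_iff.1 h).resolve_right hn) hn
    exact ha _ hi

/-- The link of an interior vertex is a directed cycle: the successor of a neighbour is an
injective, hence surjective, map of any finite set of neighbours that it preserves. -/
theorem cyclic_link_induction (hv : ∀ i, v ≠ T.corner i) {P : V → Prop} {a₀ : V}
    (h₀ : (oneSkeleton T.cx).Adj v a₀) (hP : P a₀) (step : ∀ a b, T.pos v a b → P a → P b)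
    (ha : (oneSkeleton T.cx).Adj v a) : P a := by
  classical
  have o := T.isOrientation
  have exists_next : ∀ a : {a // (oneSkeleton T.cx).Adj v a ∧ P a}, ∃ b, T.pos v a.1 b :=
    fun a => (isDart_and_isDart_of_adj a.2.1 hv).1
  choose next hnext using exists_next
  let σ : {a // (oneSkeleton T.cx).Adj v a ∧ P a} → {a // (oneSkeleton T.cx).Adj v a ∧ P a} :=
    fun a => ⟨next a, o.adj_outer (hnext a), step _ _ (hnext a) a.2.2⟩
  have hinj : Function.Injective σ := fun a b hab => by
    have hab : next a = next b := congrArg Subtype.val hab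
    exact Subtype.ext (o.coherent_left (hnext a) (hab ▸ hnext b))
  have hsurj := Finite.surjective_of_injective hinj
  refine T.isDisk.link_induction h₀ hP (fun a b hab h => ?_) ha
  rcases o.pos_or_pos hab with hab | hab
  · exact step a b hab h
  · have hab : T.pos v b a := o.rotate hab
    obtain ⟨c, hc⟩ := hsurj ⟨a, o.adj_outer hab, h⟩
    have hc : next c = a := congrArg Subtype.val hc
    exact o.coherent_left (hc ▸ hnext c) hab ▸ c.2.2

end Triangulation

/-! ### Edge paths and potentials -/

section Potential

variable {V : Type u} {A : Type*} [AddCommGroup A] (w : V → V → A)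

/-- The sum along an edge path of a cochain `w`, given by its values on directed edges. -/
def pathSum : List V → A
  | [] => 0
  | [_] => 0
  | a :: b :: l => w a b + pathSum (b :: l)

theorem pathSum_append_cons (l l' : List V) (a : V) :
    pathSum w (l ++ a :: l') = pathSum w (l ++ [a]) + pathSum w (a :: l') := by
  induction l with
  | nil => simp [pathSum]
  | cons b l ih =>
    cases l with
    | nil => simp [pathSum]
    | cons c l =>
      simp only [List.cons_append, pathSum] at ih ⊢
      rw [ih, add_assoc]

variable [DecidableEq V] {K : AbstractSimplicialComplex V} {w}

theorem pathSum_eq_of_homotopy (hw : ∀ a b c, {a, b, c} ∈ K.faces → w a b + w b c = w a c)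
    {l l' : List V} (hl : Relation.EqvGen (ElementaryHomotopy K) l l') :
    pathSum w l = pathSum w l' := by
  induction hl with
  | rel l l' hl =>
    obtain ⟨x, y, a, b, c, hf, rfl, rfl⟩ := hl
    simp only [List.append_assoc, List.cons_append, List.nil_append]
    rw [pathSum_append_cons, pathSum_append_cons w x (c :: y)]
    simp only [pathSum]
    rw [← hw a b c hf, add_assoc]
  | refl => rfl
  | symm _ _ _ ih => exact ih.symm
  | trans _ _ _ _ _ ih₁ ih₂ => exact ih₁.trans ih₂

variable [Fintype V]

theorem IsDisk.exists_isEdgePath (hK : IsDisk K) (u v : V) :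
    ∃ l, IsEdgePath K (u :: l ++ [v]) := by
  refine hK.connected_induction (P := fun v => ∃ l, IsEdgePath K (u :: l ++ [v])) (a₀ := u)
    ⟨[], ?_⟩ (fun a b hab ⟨l, hl⟩ => ⟨l ++ [a], ?_⟩) v
  · simpa [IsEdgePath] using K.singleton_mem u
  · rw [IsEdgePath, ← List.cons_append, List.append_assoc, List.singleton_append,
      List.isChain_append_cons_cons]
    exact ⟨hl, hab.2, List.isChain_singleton _⟩

theorem IsDisk.exists_potential (hK : IsDisk K)
    (hw : ∀ a b c, {a, b, c} ∈ K.faces → w a b + w b c = w a c) :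
    ∃ g : V → A, ∀ a b, (oneSkeleton K).Adj a b → w a b = g b - g a := by
  obtain ⟨v₀⟩ := hK.connected.nonempty
  choose path hpath using hK.exists_isEdgePath v₀
  choose back hback using fun v => hK.exists_isEdgePath v v₀
  have loop_sum : ∀ l, IsEdgePath K (v₀ :: l ++ [v₀]) → pathSum w (v₀ :: l ++ [v₀]) = 0 := by
    intro l hl
    rw [pathSum_eq_of_homotopy hw (hK.simply_connected v₀ l hl)]
    have := hw v₀ v₀ v₀ (by simpa using K.singleton_mem v₀)
    simpa [pathSum] using this
  refine ⟨fun v => pathSum w (v₀ :: path v ++ [v]), fun a b hab => ?_⟩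
  have regroup : ∀ u l l', v₀ :: (l ++ u :: l') ++ [v₀] = (v₀ :: l) ++ u :: (l' ++ [v₀]) := by
    simp
  have loop_b := loop_sum (path b ++ b :: back b) (by
    rw [regroup, IsEdgePath, List.isChain_split]
    exact ⟨hpath b, hback b⟩)
  have loop_ab := loop_sum (path a ++ a :: b :: back b) (by
    rw [regroup, IsEdgePath, List.cons_append (a := b), List.isChain_append_cons_cons]
    exact ⟨hpath a, hab.2, hback b⟩)
  rw [regroup, pathSum_append_cons] at loop_b
  rw [regroup, List.cons_append (a := b), pathSum_append_cons, pathSum] at loop_ab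
  rw [eq_sub_iff_add_eq, ← add_right_cancel_iff (a := pathSum w (b :: (back b ++ [v₀]))), loop_b,
    ← loop_ab]
  abel

end Potential

/-! ### Homology modulo two -/

section Edges

theorem powersetCard_two_triple {V : Type*} [DecidableEq V] {a b c : V} (hab : a ≠ b)
    (hac : a ≠ c) (hbc : b ≠ c) :
    Finset.powersetCard 2 {a, b, c} = {{a, b}, {a, c}, ({b, c} : Finset V)} := by
  ext e
  simp only [Finset.mem_powersetCard, Finset.card_eq_two, Finset.mem_insert,
    Finset.mem_singleton]
  constructor
  · rintro ⟨hs, x, y, hxy, rfl⟩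
    have hx := hs (Finset.mem_insert_self x {y})
    have hy := hs (Finset.mem_insert_of_mem (Finset.mem_singleton_self y))
    simp only [Finset.mem_insert, Finset.mem_singleton] at hx hy
    rcases hx with rfl | rfl | rfl <;> rcases hy with rfl | rfl | rfl <;>
      simp_all [Finset.pair_comm]
  · rintro (rfl | rfl | rfl)
    · exact ⟨by grind, a, b, hab, rfl⟩
    · exact ⟨by grind, a, c, hac, rfl⟩
    · exact ⟨by grind, b, c, hbc, rfl⟩

theorem sum_powersetCard_two {V A : Type*} [DecidableEq V] [AddCommMonoid A] {a b c : V}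
    (hab : a ≠ b) (hac : a ≠ c) (hbc : b ≠ c) (f : Finset V → A) :
    ∑ e ∈ Finset.powersetCard 2 {a, b, c}, f e = f {a, b} + f {a, c} + f {b, c} := by
  have hab_ac : ({a, b} : Finset V) ≠ {a, c} := fun h => by
    simpa [hab.symm, hbc] using Finset.ext_iff.1 h b
  have hab_bc : ({a, b} : Finset V) ≠ {b, c} := fun h => by
    simpa [hab, hac] using Finset.ext_iff.1 h a
  have hac_bc : ({a, c} : Finset V) ≠ {b, c} := fun h => by
    simpa [hab, hac] using Finset.ext_iff.1 h a
  rw [powersetCard_two_triple hab hac hbc, Finset.sum_insert (by simp [hab_ac, hab_bc]),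
    Finset.sum_pair hac_bc, add_assoc]

variable {V : Type u} [Fintype V]

/-- The finite set of edges of a complex. -/
noncomputable def edges (K : AbstractSimplicialComplex V) : Finset (Finset V) :=
  open Classical in Finset.univ.filter fun e => IsEdge K e

theorem mem_edges {K : AbstractSimplicialComplex V} {e : Finset V} :
    e ∈ edges K ↔ IsEdge K e := by
  simp [edges]

theorem extend_edge {K : AbstractSimplicialComplex V} (h : edges K → ZMod 2) (e : edges K) :
    Function.extend Subtype.val h 0 e.1 = h e :=
  Subtype.val_injective.extend_apply h 0 e

variable [DecidableEq V]

/-- The incidences modulo two of edges and triangles. -/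
noncomputable def edgeTriangle (K : AbstractSimplicialComplex V) :
    Matrix (edges K) (triangles K) (ZMod 2) :=
  fun e t => if e.1 ⊆ t.1 then 1 else 0

/-- The incidences modulo two of edges and vertices. -/
noncomputable def edgeVertex (K : AbstractSimplicialComplex V) : Matrix (edges K) V (ZMod 2) :=
  fun e v => if v ∈ e.1 then 1 else 0

/-- The edges of the complex that join vertices of `S`, as a chain modulo two. -/
noncomputable def edgeChain (K : AbstractSimplicialComplex V) (S : Finset V) :
    edges K → ZMod 2 :=
  fun e => if e.1 ⊆ S then 1 else 0

variable {K : AbstractSimplicialComplex V}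

theorem dotProduct_edgeChain (h : edges K → ZMod 2) {S : Finset V}
    (hE : ∀ e ⊆ S, e.card = 2 → IsEdge K e) :
    h ⬝ᵥ edgeChain K S = ∑ e ∈ S.powersetCard 2, Function.extend Subtype.val h 0 e := by
  simp only [dotProduct, edgeChain, mul_ite, mul_one, mul_zero, ← extend_edge h]
  rw [Finset.sum_coe_sort (edges K) fun e =>
    if e ⊆ S then Function.extend Subtype.val h 0 e else 0, ← Finset.sum_filter]
  congr 1
  ext e
  rw [Finset.mem_filter, Finset.mem_powersetCard, mem_edges]
  exact ⟨fun h => ⟨h.2, h.1.2⟩, fun h => ⟨hE e h.1 h.2, h.1⟩⟩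

theorem dotProduct_edgeChain_triple (h : edges K → ZMod 2) {a b c : V} (hab : a ≠ b) (hac : a ≠ c)
    (hbc : b ≠ c) (hE : ∀ e ⊆ {a, b, c}, e.card = 2 → IsEdge K e) :
    h ⬝ᵥ edgeChain K {a, b, c} = Function.extend Subtype.val h 0 {a, b} +
      Function.extend Subtype.val h 0 {a, c} + Function.extend Subtype.val h 0 {b, c} := by
  rw [dotProduct_edgeChain h hE, sum_powersetCard_two hab hac hbc]

theorem edgeVertex_mulVec (g : V → ZMod 2) (e : edges K) :
    (edgeVertex K).mulVec g e = ∑ v ∈ e.1, g v := by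
  simp [Matrix.mulVec, dotProduct, edgeVertex, Finset.sum_ite_mem]

theorem edgeVertex_mulVec_pair (g : V → ZMod 2) {a b : V} (hab : a ≠ b) (he : {a, b} ∈ edges K) :
    (edgeVertex K).mulVec g ⟨{a, b}, he⟩ = g a + g b := by
  rw [edgeVertex_mulVec, Finset.sum_pair hab]

theorem edgeChain_vecMul_edgeVertex {S : Finset V} (hS : S.card = 3)
    (hE : ∀ e ⊆ S, e.card = 2 → IsEdge K e) :
    Matrix.vecMul (edgeChain K S) (edgeVertex K) = 0 := by
  obtain ⟨a, b, c, hab, hac, hbc, rfl⟩ := Finset.card_eq_three.1 hS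
  ext v
  have value : ∀ x y, x ≠ y → {x, y} ⊆ ({a, b, c} : Finset V) →
      Function.extend Subtype.val ((edgeVertex K).transpose v) 0 {x, y} =
        if v ∈ ({x, y} : Finset V) then 1 else 0 := fun x y hxy hs =>
    extend_edge _ (⟨_, mem_edges.2 (hE _ hs (Finset.card_pair hxy))⟩ : edges K)
  change edgeChain K {a, b, c} ⬝ᵥ (edgeVertex K).transpose v = 0
  rw [dotProduct_comm, dotProduct_edgeChain_triple _ hab hac hbc hE, value a b hab (by grind),
    value a c hac (by grind), value b c hbc (by grind)]
  have h2 : (1 + 1 : ZMod 2) = 0 := by decide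
  by_cases v = a <;> by_cases v = b <;> by_cases v = c <;> simp_all

theorem edgeTriangle_transpose_mul_edgeVertex (K : AbstractSimplicialComplex V) :
    (edgeTriangle K).transpose * edgeVertex K = 0 := by
  ext t v
  exact congrFun (edgeChain_vecMul_edgeVertex (mem_triangles.1 t.2).2
    fun e he hc => isEdge_of_subset t.2 he hc) v

theorem extend_add_extend_of_vecMul_eq_zero {h : edges K → ZMod 2}
    (hh : Matrix.vecMul h (edgeTriangle K) = 0) {a b c : V} (hf : {a, b, c} ∈ K.faces) :
    Function.extend Subtype.val h 0 {a, b} + Function.extend Subtype.val h 0 {b, c} =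
      Function.extend Subtype.val h 0 {a, c} := by
  have loop : ∀ a, Function.extend Subtype.val h 0 {a, a} = 0 := fun a => by
    refine Function.extend_apply' _ _ _ ?_
    rintro ⟨e, he⟩
    simpa [he] using (mem_edges.1 e.2).2
  obtain rfl | hab := eq_or_ne a b
  · rw [loop, zero_add]
  obtain rfl | hbc := eq_or_ne b c
  · rw [loop, add_zero]
  obtain rfl | hac := eq_or_ne a c
  · rw [loop, Finset.pair_comm b a, CharTwo.add_self_eq_zero]
  have ht : {a, b, c} ∈ triangles K :=
    mem_triangles.2 ⟨hf, Finset.card_eq_three.2 ⟨_, _, _, hab, hac, hbc, rfl⟩⟩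
  have hsum : h ⬝ᵥ edgeChain K {a, b, c} = 0 := congrFun hh ⟨_, ht⟩
  rw [dotProduct_edgeChain_triple h hab hac hbc fun e => isEdge_of_subset ht] at hsum
  rw [← CharTwo.add_eq_zero, ← hsum]
  ring

theorem IsDisk.exists_edgeVertex_mulVec_eq (hK : IsDisk K) {h : edges K → ZMod 2}
    (hh : Matrix.vecMul h (edgeTriangle K) = 0) : ∃ g, (edgeVertex K).mulVec g = h := by
  obtain ⟨g, hg⟩ := hK.exists_potential (w := fun a b => Function.extend Subtype.val h 0 {a, b})
    fun a b c => extend_add_extend_of_vecMul_eq_zero hh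
  refine ⟨g, ?_⟩
  ext ⟨e, he⟩
  obtain ⟨a, b, hab, rfl⟩ := Finset.card_eq_two.1 (mem_edges.1 he).2
  have := hg a b (isEdge_pair_iff.1 (mem_edges.1 he))
  rw [edgeVertex_mulVec_pair g hab, add_comm, ← CharTwo.sub_eq_add, ← this]
  exact extend_edge h ⟨_, he⟩

theorem exists_mulVec_eq_of_forall_vecMul {F m n : Type*} [Field F] [Fintype m] [Fintype n]
    (A : Matrix m n F) (b : m → F) (hb : ∀ h, Matrix.vecMul h A = 0 → h ⬝ᵥ b = 0) :
    ∃ x, A.mulVec x = b := by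
  classical
  by_contra hne
  have hnot : b ∉ LinearMap.range A.mulVecLin := hne
  obtain ⟨φ, hφ, hker⟩ := Submodule.exists_le_ker_of_notMem hnot
  have hφ_eq : ∀ x, φ x = (fun i => φ (Pi.single i 1)) ⬝ᵥ x := fun x => by
    rw [LinearMap.pi_apply_eq_sum_univ φ x]
    refine Finset.sum_congr rfl fun i _ => ?_
    rw [smul_eq_mul, mul_comm]
    congr 2
    ext j
    simp [Pi.single_apply, eq_comm]
  refine hφ ?_
  rw [hφ_eq]
  refine hb _ (funext fun j => ?_)
  have : φ (A.mulVecLin (Pi.single j 1)) = 0 := hker ⟨_, rfl⟩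
  rw [hφ_eq, Matrix.mulVecLin_apply, Matrix.dotProduct_mulVec] at this
  simpa using this

theorem IsDisk.exists_filling (hK : IsDisk K) {S : Finset V} (hS : S.card = 3)
    (hE : ∀ e ⊆ S, e.card = 2 → IsEdge K e) :
    ∃ c, (edgeTriangle K).mulVec c = edgeChain K S := by
  refine exists_mulVec_eq_of_forall_vecMul _ _ fun h hh => ?_
  obtain ⟨g, rfl⟩ := hK.exists_edgeVertex_mulVec_eq hh
  rw [dotProduct_comm, Matrix.dotProduct_mulVec, edgeChain_vecMul_edgeVertex hS hE,
    zero_dotProduct]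

theorem IsDisk.edgeTriangle_mulVec_injective (hK : IsDisk K) :
    Function.Injective (edgeTriangle K).mulVec := by
  rw [← Matrix.coe_mulVecLin, injective_iff_map_eq_zero]
  intro c hc
  by_contra hne
  obtain ⟨t₀, ht₀⟩ := Function.ne_iff.1 hne
  obtain ⟨t, ⟨htK, hct⟩, e, he, hcard, hfree⟩ :=
    hK.exists_free_edge (I := {t | ∃ h : t ∈ triangles K, c ⟨t, h⟩ ≠ 0}) (fun t ht => ht.1)
      ⟨t₀.1, t₀.2, ht₀⟩
  have hsum := congrFun hc ⟨e, mem_edges.2 (isEdge_of_subset htK he hcard)⟩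
  simp only [Matrix.mulVecLin_apply, Matrix.mulVec, dotProduct, edgeTriangle, ite_mul, one_mul,
    zero_mul, Pi.zero_apply] at hsum
  rw [Finset.sum_eq_single_of_mem ⟨t, htK⟩ (Finset.mem_univ _), if_pos he] at hsum
  · exact hct hsum
  · intro t' _ hne'
    refine ite_eq_right_iff.2 fun hs => by_contra fun h0 => hne' (Subtype.ext ?_)
    exact hfree t' ⟨t'.2, h0⟩ hs

theorem IsDisk.ker_edgeTriangle_transpose (hK : IsDisk K) :
    LinearMap.ker (edgeTriangle K).transpose.mulVecLin =
      LinearMap.range (edgeVertex K).mulVecLin := by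
  ext h
  rw [LinearMap.mem_ker, Matrix.mulVecLin_apply, Matrix.mulVec_transpose]
  refine ⟨fun hh => hK.exists_edgeVertex_mulVec_eq hh, ?_⟩
  rintro ⟨g, rfl⟩
  rw [← Matrix.mulVec_transpose, Matrix.mulVecLin_apply, Matrix.mulVec_mulVec,
    edgeTriangle_transpose_mul_edgeVertex, Matrix.zero_mulVec]

theorem IsDisk.ker_edgeVertex (hK : IsDisk K) :
    LinearMap.ker (edgeVertex K).mulVecLin = Submodule.span (ZMod 2) {(1 : V → ZMod 2)} := by
  obtain ⟨v₀⟩ := hK.connected.nonempty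
  ext g
  rw [LinearMap.mem_ker, Matrix.mulVecLin_apply, Submodule.mem_span_singleton]
  constructor
  · refine fun hg => ⟨g v₀, funext fun v => ?_⟩
    rw [Pi.smul_apply, Pi.one_apply, smul_eq_mul, mul_one]
    refine hK.connected_induction (P := fun v => g v₀ = g v) rfl (fun a b hab ha => ?_) v
    have := congrFun hg ⟨_, mem_edges.2 (isEdge_pair_iff.2 hab)⟩
    rw [edgeVertex_mulVec_pair g hab.1] at this
    exact ha.trans (CharTwo.add_eq_zero.1 this)
  · rintro ⟨x, rfl⟩
    ext ⟨e, he⟩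
    obtain ⟨a, b, hab, rfl⟩ := Finset.card_eq_two.1 (mem_edges.1 he).2
    rw [edgeVertex_mulVec_pair _ hab]
    exact CharTwo.add_self_eq_zero _

theorem IsDisk.card_triangles_add_card (hK : IsDisk K) :
    (triangles K).card + Fintype.card V = (edges K).card + 1 := by
  have rank_edgeTriangle := LinearMap.finrank_range_of_inj (f := (edgeTriangle K).mulVecLin)
    hK.edgeTriangle_mulVec_injective
  have rank_transpose := Matrix.rank_transpose (edgeTriangle K)
  have rank_nullity₂ := LinearMap.finrank_range_add_finrank_ker (edgeTriangle K).transpose.mulVecLin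
  have rank_nullity₁ := LinearMap.finrank_range_add_finrank_ker (edgeVertex K).mulVecLin
  have := hK.connected.nonempty
  rw [hK.ker_edgeTriangle_transpose] at rank_nullity₂
  rw [hK.ker_edgeVertex, finrank_span_singleton one_ne_zero] at rank_nullity₁
  simp only [Matrix.rank, Module.finrank_fintype_fun_eq_card, Fintype.card_coe] at *
  omega

end Edges

namespace Triangulation

variable {V : Type u} [Fintype V] [DecidableEq V] {T : Triangulation V}

/-! ### Counting faces -/

theorem card_trianglesAt {e : Finset V} (he : IsEdge T.cx e) :
    (trianglesAt T.cx e).card = 1 ∨ (trianglesAt T.cx e).card = 2 := by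
  have hle : (trianglesAt T.cx e).card ≤ 2 := T.isDisk.edge_card_le e he
  obtain ⟨t, ht, hs⟩ := T.isDisk.pure e he.1
  have hpos : 0 < (trianglesAt T.cx e).card := Finset.card_pos.2 ⟨t, mem_trianglesAt.2 ⟨ht, hs⟩⟩
  omega

theorem card_boundaryEdges (T : Triangulation V) :
    ((edges T.cx).filter fun e => (trianglesAt T.cx e).card = 1).card = 4 := by
  have h : ((edges T.cx).filter fun e => (trianglesAt T.cx e).card = 1) =
      Finset.univ.image fun i : Fin 4 => ({T.corner i, T.corner (i + 1)} : Finset V) := by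
    ext e
    rw [Finset.mem_filter, mem_edges, Finset.mem_image]
    refine (T.boundary_iff e).trans ?_
    simp [eq_comm]
  rw [h, Finset.card_image_of_injective, Finset.card_univ, Fintype.card_fin]
  intro i j (hij : ({T.corner i, T.corner (i + 1)} : Finset V) = {T.corner j, T.corner (j + 1)})
  have mem_iff : ∀ k, (k = i ∨ k = i + 1) ↔ (k = j ∨ k = j + 1) := fun k => by
    simpa [T.corner_injective.eq_iff] using Finset.ext_iff.1 hij (T.corner k)
  clear hij h
  revert i j
  decide

theorem three_mul_card_triangles (T : Triangulation V) :
    3 * (triangles T.cx).card + 4 = 2 * (edges T.cx).card := by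
  have edges_of_triangle : ∀ t ∈ triangles T.cx,
      ((edges T.cx).bipartiteBelow (· ⊆ ·) t).card = 3 := by
    intro t ht
    have : (edges T.cx).bipartiteBelow (· ⊆ ·) t = t.powersetCard 2 := by
      ext e
      rw [Finset.mem_bipartiteBelow, Finset.mem_powersetCard, mem_edges]
      exact ⟨fun h => ⟨h.2, h.1.2⟩, fun h => ⟨isEdge_of_subset ht h.1 h.2, h.1⟩⟩
    rw [this, Finset.card_powersetCard, (mem_triangles.1 ht).2, Nat.choose_succ_self_right]
  have triangles_of_edge : ∀ e ∈ edges T.cx, ((triangles T.cx).bipartiteAbove (· ⊆ ·) e).card +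
      (if (trianglesAt T.cx e).card = 1 then 1 else 0) = 2 := by
    intro e he
    change (trianglesAt T.cx e).card + _ = 2
    rcases card_trianglesAt (mem_edges.1 he) with h | h <;> simp [h]
  calc 3 * (triangles T.cx).card + 4
    _ = ∑ e ∈ edges T.cx, ((triangles T.cx).bipartiteAbove (· ⊆ ·) e).card +
        ∑ e ∈ edges T.cx, (if (trianglesAt T.cx e).card = 1 then 1 else 0) := by
      rw [Finset.sum_card_bipartiteAbove_eq_sum_card_bipartiteBelow,
        Finset.sum_congr rfl edges_of_triangle, Finset.sum_const, smul_eq_mul, mul_comm,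
        Finset.sum_boole, T.card_boundaryEdges]
      rfl
    _ = 2 * (edges T.cx).card := by
      rw [← Finset.sum_add_distrib, Finset.sum_congr rfl triangles_of_edge, Finset.sum_const,
        smul_eq_mul, mul_comm]

theorem mem_interiorVertices {v : V} : v ∈ T.interiorVertices ↔ ∀ i, v ≠ T.corner i := by
  simp [interiorVertices]

theorem card_interiorVertices (T : Triangulation V) :
    T.interiorVertices.card + 4 = Fintype.card V := by
  have h : T.interiorVerticesᶜ = Finset.univ.image T.corner := by
    ext v
    simp [mem_interiorVertices, eq_comm]
  rw [← Finset.card_add_card_compl T.interiorVertices, h,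
    Finset.card_image_of_injective _ T.corner_injective, Finset.card_univ, Fintype.card_fin]

theorem card_triangles (T : Triangulation V) :
    (triangles T.cx).card = 2 * T.interiorVertices.card + 2 := by
  have euler : (triangles T.cx).card + Fintype.card V = (edges T.cx).card + 1 :=
    T.isDisk.card_triangles_add_card
  have incidences := T.three_mul_card_triangles
  have vertices := T.card_interiorVertices
  omega

/-! ### The inside of a 3-cycle -/

theorem CrossAdj.symm {S t t' : Finset V} (h : T.CrossAdj S t t') : T.CrossAdj S t' t :=
  let ⟨ht, ht', e, he, hs, hs', heS⟩ := h
  ⟨ht', ht, e, he, hs', hs, heS⟩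

theorem CrossAdj.isInside {S t t' : Finset V} (h : T.CrossAdj S t t') (ht : T.IsInside S t) :
    T.IsInside S t' :=
  ⟨h.2.1, fun ⟨t'', hpath, hout⟩ => ht.2 ⟨t'', hpath.head h, hout⟩⟩

theorem IsInside.of_mem {S t t' : Finset V} {v : V} (ht : T.IsInside S t) (hv : v ∉ S)
    (hvt : v ∈ t) (ht' : t' ∈ triangles T.cx) (hvt' : v ∈ t') : T.IsInside S t' := by
  refine T.isDisk.star_induction (P := T.IsInside S) ht.1 hvt ht
    (fun t t' a h h' ha hs hs' hP => ?_) ht' hvt'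
  exact CrossAdj.isInside ⟨h, h', {v, a}, isEdge_of_subset h hs (Finset.card_pair ha.symm), hs,
    hs', fun h => hv (h (by simp))⟩ hP

theorem IsInside.of_adj {S t t' : Finset V} {u v : V} (ht : T.IsInside S t) (hv : v ∉ S)
    (hvt : v ∈ t) (huv : (oneSkeleton T.cx).Adj v u) (hu : u ∉ S) (ht' : t' ∈ triangles T.cx)
    (hut' : u ∈ t') : T.IsInside S t' := by
  obtain ⟨t₁, ht₁, hs⟩ := T.isDisk.exists_triangle_of_adj huv
  exact (ht.of_mem hv hvt ht₁ (hs (by simp))).of_mem hu (hs (by simp)) ht' hut'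

theorem IsInside.mem_interiorVertices {S t : Finset V} {v : V} (ht : T.IsInside S t) (hv : v ∉ S)
    (hvt : v ∈ t) : v ∈ T.interiorVertices := by
  refine Triangulation.mem_interiorVertices.2 ?_
  rintro i rfl
  obtain ⟨c, hc⟩ := T.corner_pos i
  have h := ht.of_mem hv hvt (T.pos_triangle _ _ _ hc) (by simp)
  exact h.2 ⟨_, .refl, _, (T.boundary_iff _).2 ⟨i, rfl⟩, by grind, fun h => hv (h (by simp))⟩

theorem IsOutside.of_forall_not_subset {S S' t : Finset V}
    (h : ∀ t ∈ triangles T.cx, T.IsOutside S t → ∀ e ⊆ t, ¬ e ⊆ S → ¬ e ⊆ S')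
    (ht : t ∈ triangles T.cx) (hout : T.IsOutside S t) : T.IsOutside S' t := by
  obtain ⟨t', hpath, e, he, het, heS⟩ := hout
  induction hpath using Relation.ReflTransGen.head_induction_on with
  | refl => exact ⟨t', .refl, e, he, het, h t' ht ⟨t', .refl, e, he, het, heS⟩ e het heS⟩
  | @head t t₁ hcross hpath ih =>
    obtain ⟨t₂, hpath', hout⟩ := ih hcross.2.1
    obtain ⟨-, ht₁, e', he', hs, hs', he'S⟩ := hcross
    have : T.IsOutside S t₁ := ⟨t', hpath, e, he, het, heS⟩
    exact ⟨t₂, hpath'.head ⟨ht, ht₁, e', he', hs, hs', h t₁ ht₁ this e' hs' he'S⟩, hout⟩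

theorem IsInside.trans {S t t₀ : Finset V} {v w z : V} (ht₀ : T.IsInside S t₀) (hv : v ∉ S)
    (hvt₀ : v ∈ t₀) (hw : (oneSkeleton T.cx).Adj v w) (hz : (oneSkeleton T.cx).Adj v z)
    (ht : T.IsInside {v, w, z} t) : T.IsInside S t := by
  refine ⟨ht.1, fun hout => ht.2 (hout.of_forall_not_subset
    (fun t' ht' hout' e het heS he => ?_) ht.1)⟩
  obtain ⟨u, hue, huS⟩ := Finset.not_subset.1 heS
  have hu := he hue
  simp only [Finset.mem_insert, Finset.mem_singleton] at hu
  refine (?_ : T.IsInside S t').2 hout'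
  rcases hu with rfl | rfl | rfl
  · exact ht₀.of_mem hv hvt₀ ht' (het hue)
  · exact ht₀.of_adj hv hvt₀ hw huS ht' (het hue)
  · exact ht₀.of_adj hv hvt₀ hz huS ht' (het hue)

/-! ### The Jordan curve theorem for 3-cycles -/

theorem edgeTriangle_mulVec {K : AbstractSimplicialComplex V} (f : Finset V → ZMod 2)
    (e : edges K) :
    (edgeTriangle K).mulVec (fun t => f t.1) e = ∑ t ∈ trianglesAt K e.1, f t := by
  simp only [Matrix.mulVec, dotProduct, edgeTriangle, ite_mul, one_mul, zero_mul, trianglesAt]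
  rw [Finset.sum_filter, ← Finset.sum_coe_sort (triangles K)]

theorem eq_zero_of_vecMul_edgeVertex {K : AbstractSimplicialComplex V} {x : edges K → ZMod 2}
    (hx : Matrix.vecMul x (edgeVertex K) = 0) {e₀ : edges K} {c : V} (he₀ : x e₀ = 0)
    (hsupp : ∀ e, ¬ e.1 ⊆ insert c e₀.1 → x e = 0) : x = 0 := by
  have mem_of_ne : ∀ e, x e ≠ 0 → c ∈ e.1 := by
    intro e he
    by_contra hc
    have hsub := (Finset.subset_insert_iff_of_notMem hc).1 (not_imp_comm.1 (hsupp e) he)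
    have heq := Finset.eq_of_subset_of_card_le hsub
      (by rw [(mem_edges.1 e.2).2, (mem_edges.1 e₀.2).2])
    exact he (Subtype.ext heq ▸ he₀)
  have eq_pair : ∀ e, x e ≠ 0 → ∀ v ∈ e.1, v ≠ c → e.1 = {v, c} := fun e he v hv hvc =>
    (Finset.eq_of_subset_of_card_le (by grind)
      (by rw [(mem_edges.1 e.2).2, Finset.card_pair hvc])).symm
  ext e
  by_contra he
  obtain ⟨v, hv, hvc⟩ := e.1.exists_mem_ne (by rw [(mem_edges.1 e.2).2]; norm_num) c
  have hsum : ∑ e', x e' * edgeVertex K e' v = 0 := congrFun hx v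
  rw [Finset.sum_eq_single_of_mem e (Finset.mem_univ e)] at hsum
  · simp only [edgeVertex, hv, if_true, mul_one] at hsum
    exact he hsum
  · intro e' _ hne
    by_contra h
    obtain ⟨he', hv'⟩ : x e' ≠ 0 ∧ v ∈ e'.1 := by simpa [edgeVertex, and_comm] using h
    exact hne (Subtype.ext ((eq_pair e' he' v hv' hvc).trans (eq_pair e he v hv hvc).symm))

theorem sum_trianglesAt_of_mem {K : AbstractSimplicialComplex V} {e t : Finset V}
    (he : IsBoundaryEdge K e) (ht : t ∈ trianglesAt K e) (f : Finset V → ZMod 2) :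
    ∑ t ∈ trianglesAt K e, f t = f t := by
  obtain ⟨t', h⟩ := Finset.card_eq_one.1 he.2
  rw [h, Finset.mem_singleton] at ht
  rw [h, Finset.sum_singleton, ht]

theorem sum_trianglesAt_of_mem_of_mem {e t t' : Finset V} (he : IsEdge T.cx e)
    (ht : t ∈ trianglesAt T.cx e) (ht' : t' ∈ trianglesAt T.cx e) (hne : t ≠ t')
    (f : Finset V → ZMod 2) : ∑ t ∈ trianglesAt T.cx e, f t = f t + f t' := by
  have h : {t, t'} = trianglesAt T.cx e :=
    Finset.eq_of_subset_of_card_le (Finset.insert_subset ht (Finset.singleton_subset_iff.2 ht'))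
      (by rw [Finset.card_pair hne]; exact T.isDisk.edge_card_le e he)
  rw [← h, Finset.sum_pair hne]

theorem IsOutside.eq_zero {S : Finset V} {f : Finset V → ZMod 2}
    (hf : ∀ e, IsEdge T.cx e → ¬ e ⊆ S → ∑ t ∈ trianglesAt T.cx e, f t = 0) {t : Finset V}
    (ht : t ∈ triangles T.cx) (hout : T.IsOutside S t) : f t = 0 := by
  obtain ⟨t', hpath, e, he, het, heS⟩ := hout
  induction hpath using Relation.ReflTransGen.head_induction_on with
  | refl => rw [← sum_trianglesAt_of_mem he (mem_trianglesAt.2 ⟨ht, het⟩) f, hf e he.1 heS]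
  | @head t t₁ h _ ih =>
    obtain ⟨-, ht₁, e', he', hs, hs', he'S⟩ := h
    obtain rfl | hne := eq_or_ne t t₁
    · exact ih ht₁
    · have hsum := hf e' he' he'S
      rw [sum_trianglesAt_of_mem_of_mem he' (mem_trianglesAt.2 ⟨ht, hs⟩)
        (mem_trianglesAt.2 ⟨ht₁, hs'⟩) hne, ih ht₁, add_zero] at hsum
      exact hsum

theorem IsSubdivision.exists_isInside {S : Finset V} (hS : T.IsSubdivision S) :
    ∃ t, T.IsInside S t := by
  by_contra! hno
  obtain ⟨c, hc⟩ := T.isDisk.exists_filling hS.1 hS.2.1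
  obtain ⟨f, rfl⟩ : ∃ f : Finset V → ZMod 2, (fun t => f t.1) = c :=
    ⟨Function.extend Subtype.val c 0, funext fun t => Subtype.val_injective.extend_apply c 0 t⟩
  have hf : ∀ e, IsEdge T.cx e → ¬ e ⊆ S → ∑ t ∈ trianglesAt T.cx e, f t = 0 := by
    intro e he heS
    rw [← edgeTriangle_mulVec f ⟨e, mem_edges.2 he⟩, hc]
    exact if_neg heS
  have outside : ∀ t ∈ triangles T.cx, T.IsOutside S t := fun t ht =>
    not_not.1 fun h => hno t ⟨ht, h⟩
  obtain ⟨e, heS, hcard⟩ : ∃ e ⊆ S, e.card = 2 :=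
    Finset.exists_subset_card_eq (by rw [hS.1]; norm_num)
  have he := congrFun hc ⟨e, mem_edges.2 (hS.2.1 e heS hcard)⟩
  rw [edgeTriangle_mulVec, Finset.sum_eq_zero fun t ht => IsOutside.eq_zero hf
    (mem_trianglesAt.1 ht).1 (outside t (mem_trianglesAt.1 ht).1)] at he
  exact zero_ne_one (he.trans (if_pos heS))

open Classical in
/-- The sum modulo two of the triangles inside the 3-cycle with vertex set `S`. -/
noncomputable def insideChain (T : Triangulation V) (S t : Finset V) : ZMod 2 :=
  if T.IsInside S t then 1 else 0

theorem sum_insideChain_of_not_subset {S e : Finset V} (he : IsEdge T.cx e) (hS : ¬ e ⊆ S) :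
    ∑ t ∈ trianglesAt T.cx e, T.insideChain S t = 0 := by
  rcases card_trianglesAt he with hc | hc
  · obtain ⟨t, ht, hs⟩ := T.isDisk.pure e he.1
    rw [sum_trianglesAt_of_mem ⟨he, hc⟩ (mem_trianglesAt.2 ⟨ht, hs⟩)]
    exact if_neg fun h => h.2 ⟨t, .refl, e, ⟨he, hc⟩, hs, hS⟩
  · obtain ⟨t, t', hne, ht⟩ := Finset.card_eq_two.1 hc
    obtain ⟨htK, het⟩ : t ∈ triangles T.cx ∧ e ⊆ t := mem_trianglesAt.1 (by simp [ht])
    obtain ⟨htK', het'⟩ : t' ∈ triangles T.cx ∧ e ⊆ t' := mem_trianglesAt.1 (by simp [ht])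
    have hcross : T.CrossAdj S t t' := ⟨htK, htK', e, he, het, het', hS⟩
    have : T.IsInside S t ↔ T.IsInside S t' := ⟨hcross.isInside, hcross.symm.isInside⟩
    rw [ht, Finset.sum_pair hne, insideChain, insideChain, this]
    exact CharTwo.add_self_eq_zero _

/-- If both triangles at `e` were inside, the boundary of the inside would be a cycle supported on
the other two edges of `S`, hence zero, whereas only the zero chain has zero boundary. -/
theorem IsSubdivision.exists_not_isInside {S e : Finset V} (hS : T.IsSubdivision S)
    (he : IsInteriorEdge T.cx e) (heS : e ⊆ S) :
    ∃ t ∈ triangles T.cx, e ⊆ t ∧ ¬ T.IsInside S t := by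
  by_contra! hno
  obtain ⟨x, hx⟩ : ∃ x, x = (edgeTriangle T.cx).mulVec fun t => T.insideChain S t.1 := ⟨_, rfl⟩
  have boundary : ∀ e, x e = ∑ t ∈ trianglesAt T.cx e.1, T.insideChain S t := fun e =>
    hx ▸ edgeTriangle_mulVec _ e
  have cycle : Matrix.vecMul x (edgeVertex T.cx) = 0 := by
    rw [hx, ← Matrix.vecMul_transpose, Matrix.vecMul_vecMul, edgeTriangle_transpose_mul_edgeVertex,
      Matrix.vecMul_zero]
  have inside_one : ∀ t ∈ trianglesAt T.cx e, T.insideChain S t = 1 := fun t ht =>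
    if_pos (hno t (mem_trianglesAt.1 ht).1 (mem_trianglesAt.1 ht).2)
  have hcard : (trianglesAt T.cx e).card = 2 :=
    (card_trianglesAt he.1).resolve_left fun h => he.2 ⟨he.1, h⟩
  have zero_at : x ⟨e, mem_edges.2 he.1⟩ = 0 := by
    refine (boundary _).trans ((Finset.sum_congr rfl inside_one).trans ?_)
    rw [Finset.sum_const, hcard]
    rfl
  obtain ⟨c, hc⟩ : ∃ c, insert c e = S := by
    obtain ⟨c, -, hc⟩ := Finset.covBy_iff_exists_insert.1
      (Finset.covBy_iff_card_sdiff_eq_one.2 ⟨heS, by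
        rw [Finset.card_sdiff_of_subset heS, hS.1, he.1.2]⟩)
    exact ⟨c, hc⟩
  have zero : x = 0 := eq_zero_of_vecMul_edgeVertex cycle zero_at fun e' he' => by
    rw [boundary, sum_insideChain_of_not_subset (mem_edges.1 e'.2) (hc ▸ he')]
  obtain ⟨t, ht⟩ := hS.exists_isInside
  have := congrFun (T.isDisk.edgeTriangle_mulVec_injective
    ((hx.symm.trans zero).trans (Matrix.mulVec_zero _).symm)) ⟨t, ht.1⟩
  exact one_ne_zero ((if_pos ht).symm.trans this)

/-! ### The link condition -/

theorem identified_iff {x y : V} {s s' : Finset V} : T.Identified x y s s' ↔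
    (s = {x} ∧ s' = {y}) ∨ ∃ z, {x, y, z} ∈ triangles T.cx ∧ s = {z, x} ∧ s' = {z, y} := by
  constructor
  · rintro (_ | ⟨z, hz⟩)
    · exact Or.inl ⟨rfl, rfl⟩
    · exact Or.inr ⟨z, hz, rfl, rfl⟩
  · rintro (⟨rfl, rfl⟩ | ⟨z, hz, rfl, rfl⟩)
    · exact .vertex
    · exact .edge z hz

theorem isSubdivision_of_adj {x y z : V} (hxy : (oneSkeleton T.cx).Adj x y)
    (hxz : (oneSkeleton T.cx).Adj x z) (hyz : (oneSkeleton T.cx).Adj y z)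
    (h : {x, y, z} ∉ triangles T.cx) : T.IsSubdivision {x, y, z} := by
  refine ⟨Finset.card_eq_three.2 ⟨_, _, _, hxy.1, hxz.1, hyz.1, rfl⟩, fun e he hc => ?_, h⟩
  have he := Finset.mem_powersetCard.2 ⟨he, hc⟩
  rw [powersetCard_two_triple hxy.1 hxz.1 hyz.1] at he
  simp only [Finset.mem_insert, Finset.mem_singleton] at he
  rcases he with rfl | rfl | rfl <;> exact isEdge_pair_iff.2 ‹_›

end Triangulation

theorem IsDisk.exists_erase_notMem_triangles {V : Type u} [Fintype V] [DecidableEq V]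
    {K : AbstractSimplicialComplex V} (hK : IsDisk K) {W : Finset V} (hW : W.card = 4) :
    ∃ u ∈ W, W.erase u ∉ triangles K := by
  by_contra! h
  obtain ⟨u₀, hu₀⟩ := Finset.card_pos.1 (hW ▸ by norm_num : 0 < W.card)
  obtain ⟨-, ⟨u, hu, rfl⟩, e, he, hcard, hfree⟩ :=
    hK.exists_free_edge (I := {t | ∃ u ∈ W, W.erase u = t}) (by rintro - ⟨u, hu, rfl⟩; exact h u hu)
      ⟨_, u₀, hu₀, rfl⟩
  obtain ⟨u', hu', hu'e⟩ := Finset.exists_mem_notMem_of_card_lt_card (s := e) (t := W.erase u)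
    (by rw [Finset.card_erase_of_mem hu]; omega)
  rw [Finset.mem_erase] at hu'
  have hsub : e ⊆ W.erase u' :=
    Finset.subset_erase.2 ⟨he.trans (Finset.erase_subset _ _), hu'e⟩
  exact hu'.1 (Finset.erase_injOn W hu'.2 hu (hfree _ ⟨u', hu'.2, rfl⟩ hsub))

namespace Triangulation

variable {V : Type u} [Fintype V] [DecidableEq V] {T : Triangulation V}

theorem identified_insert {x y : V} (hxy : (oneSkeleton T.cx).Adj x y)
    (hno : ∀ z, ¬ T.IsSubdivision {x, y, z}) {A : Finset V} (hx : x ∉ A) (hy : y ∉ A)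
    (hxA : insert x A ∈ T.cx.faces) (hyA : insert y A ∈ T.cx.faces) :
    T.Identified x y (insert x A) (insert y A) := by
  have triangle_of_mem : ∀ u ∈ A, {x, y, u} ∈ triangles T.cx := by
    intro u hu
    have hxu : (oneSkeleton T.cx).Adj x u :=
      ⟨fun h => hx (h ▸ hu), mem_faces_of_subset hxA (by grind) (by simp)⟩
    have hyu : (oneSkeleton T.cx).Adj y u :=
      ⟨fun h => hy (h ▸ hu), mem_faces_of_subset hyA (by grind) (by simp)⟩
    exact not_not.1 fun h => hno u (isSubdivision_of_adj hxy hxu hyu h)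
  have card_le := T.isDisk.card_le _ hxA
  rw [Finset.card_insert_of_notMem hx] at card_le
  obtain hc | hc | hc : A.card = 0 ∨ A.card = 1 ∨ A.card = 2 := by omega
  · rw [Finset.card_eq_zero] at hc
    subst hc
    exact .vertex
  · obtain ⟨z, rfl⟩ := Finset.card_eq_one.1 hc
    rw [Finset.pair_comm x, Finset.pair_comm y]
    exact .edge z (triangle_of_mem z (by simp))
  · have hx' : x ∉ insert y A := by simp [hx, hxy.1]
    obtain ⟨u, hu, hnot⟩ := T.isDisk.exists_erase_notMem_triangles (W := insert x (insert y A))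
      (by rw [Finset.card_insert_of_notMem hx', Finset.card_insert_of_notMem hy, hc])
    refine absurd ?_ hnot
    obtain ⟨z, w, hzw, rfl⟩ := Finset.card_eq_two.1 hc
    have hz := triangle_of_mem z (by simp)
    have hw := triangle_of_mem w (by simp)
    simp only [Finset.mem_insert, Finset.mem_singleton] at hu
    rcases hu with rfl | rfl | rfl | rfl
    · rw [Finset.erase_insert hx']
      exact mem_triangles.2 ⟨hyA, by rw [Finset.card_insert_of_notMem hy, hc]⟩
    · rw [Finset.erase_insert_of_ne hxy.1, Finset.erase_insert hy]
      exact mem_triangles.2 ⟨hxA, by rw [Finset.card_insert_of_notMem hx, hc]⟩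
    · convert hw using 1
      grind
    · convert hz using 1
      grind

theorem IsSubdivision.adj {x y z : V} (h : T.IsSubdivision {x, y, z}) :
    (oneSkeleton T.cx).Adj x y ∧ (oneSkeleton T.cx).Adj x z ∧ (oneSkeleton T.cx).Adj y z := by
  obtain ⟨hxy, hxz, hyz⟩ := Finset.card_triple_eq_three_iff.1 h.1
  exact ⟨isEdge_pair_iff.1 (h.2.1 _ (by grind) (Finset.card_pair hxy)),
    isEdge_pair_iff.1 (h.2.1 _ (by grind) (Finset.card_pair hxz)),
    isEdge_pair_iff.1 (h.2.1 _ (by grind) (Finset.card_pair hyz))⟩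

theorem IsSubdivision.exists_isInside_notMem {S : Finset V} (hS : T.IsSubdivision S) :
    ∃ t v, T.IsInside S t ∧ v ∈ t ∧ v ∉ S := by
  obtain ⟨t, ht⟩ := hS.exists_isInside
  obtain ⟨v, hvt, hvS⟩ : ∃ v ∈ t, v ∉ S := by
    by_contra! hsub
    have hcard : S.card ≤ t.card := by rw [hS.1, (mem_triangles.1 ht.1).2]
    exact hS.2.2 (Finset.eq_of_subset_of_card_le hsub hcard ▸ ht.1)
  exact ⟨t, v, ht, hvt, hvS⟩

theorem IsInside.ssubset {S t : Finset V} {v w z : V} (ht : T.IsInside S t) (hv : v ∉ S)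
    (hvt : v ∈ t) (h : T.IsSubdivision {v, w, z}) :
    {s | T.IsInside {v, w, z} s} ⊂ {s | T.IsInside S s} := by
  obtain ⟨hw, hz, -⟩ := h.adj
  refine Set.ssubset_iff_exists.2 ⟨fun s hs => ht.trans hv hvt hw hz hs, ?_⟩
  have hinterior : IsInteriorEdge T.cx {v, w} := isInteriorEdge_iff.2
    (isDart_and_isDart_of_adj hw (SquareDrawing.Triangulation.mem_interiorVertices.1
      (ht.mem_interiorVertices hv hvt)))
  obtain ⟨s, hs, hes, hout⟩ := h.exists_not_isInside hinterior (by grind)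
  exact ⟨s, ht.of_mem hv hvt hs (hes (by simp)), hout⟩

theorem exists_isSubdivision_of_not_canContract {x y : V} (hxy : (oneSkeleton T.cx).Adj x y)
    (h : ¬ T.CanContract x y) : ∃ z, T.IsSubdivision {x, y, z} := by
  by_contra! hno
  refine h fun s hs s' hs' hxys hxys' himage => or_iff_not_imp_left.2 fun hne => ?_
  have mem_iff : ∀ u, u ≠ x → u ≠ y → (u ∈ s ↔ u ∈ s') := by
    intro u hux huy
    have := Finset.ext_iff.1 himage u
    simp only [Finset.mem_image] at this
    grind
  have mem_or_iff : x ∈ s ∨ y ∈ s ↔ x ∈ s' ∨ y ∈ s' := by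
    have := Finset.ext_iff.1 himage x
    simp only [Finset.mem_image] at this
    grind
  have swapped : ∀ s s' : Finset V, (∀ u, u ≠ x → u ≠ y → (u ∈ s ↔ u ∈ s')) → x ∈ s → y ∉ s →
      x ∉ s' → y ∈ s' → ∃ A, x ∉ A ∧ y ∉ A ∧ s = insert x A ∧ s' = insert y A :=
    fun s s' hss' hxs hys hxs' hys' => ⟨s.erase x, by simp, by simp [hys],
      (Finset.insert_erase hxs).symm, by grind⟩
  have not_both : ∀ {t : Finset V}, ¬ {x, y} ⊆ t → ¬ (x ∈ t ∧ y ∈ t) := fun ht h =>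
    ht (Finset.insert_subset h.1 (Finset.singleton_subset_iff.2 h.2))
  have hns := not_both hxys
  have hns' := not_both hxys'
  have hdiff : ¬ ((x ∈ s ↔ x ∈ s') ∧ (y ∈ s ↔ y ∈ s')) := by
    refine fun h => hne (Finset.ext fun u => ?_)
    by_cases hux : u = x
    · exact hux ▸ h.1
    by_cases huy : u = y
    · exact huy ▸ h.2
    exact mem_iff u hux huy
  obtain ⟨h₁, h₂, h₃, h₄⟩ | ⟨h₁, h₂, h₃, h₄⟩ :
      (x ∈ s ∧ y ∉ s ∧ x ∉ s' ∧ y ∈ s') ∨ (x ∈ s' ∧ y ∉ s' ∧ x ∉ s ∧ y ∈ s) := by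
    tauto
  · obtain ⟨A, hx, hy, rfl, rfl⟩ := swapped s s' mem_iff h₁ h₂ h₃ h₄
    exact .inl (identified_insert hxy hno hx hy hs hs')
  · obtain ⟨A, hx, hy, rfl, rfl⟩ := swapped s' s (fun u h h' => (mem_iff u h h').symm) h₁ h₂ h₃ h₄
    exact .inr (identified_insert hxy hno hx hy hs' hs)

theorem CanContract.mem_triangles {x y z : V} (h : T.CanContract x y)
    (hxy : (oneSkeleton T.cx).Adj x y) (hxz : (oneSkeleton T.cx).Adj x z)
    (hyz : (oneSkeleton T.cx).Adj y z) : {x, y, z} ∈ triangles T.cx := by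
  have hne_xy := hxy.1
  have hne_xz := hxz.1
  have hne_yz := hyz.1
  have hzx : ({z, x} : Finset V).card = 2 := Finset.card_pair hne_xz.symm
  have himage : ({z, x} : Finset V).image (fun v => if v = y then x else v) =
      ({z, y} : Finset V).image fun v => if v = y then x else v := by
    simp [Finset.image_insert, hne_xy, hne_yz.symm]
  rcases h {z, x} hxz.symm.2 {z, y} hyz.symm.2
    (by simp [Finset.insert_subset_iff, hne_xy.symm, hne_yz])
    (by simp [Finset.insert_subset_iff, hne_xy, hne_xz]) himage with h | h | h
  · have := Finset.ext_iff.1 h x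
    grind
  · rcases identified_iff.1 h with ⟨h, -⟩ | ⟨z', hz', h, -⟩
    · rw [h, Finset.card_singleton] at hzx
      omega
    · obtain rfl : z = z' := by
        have := Finset.ext_iff.1 h z
        grind
      exact hz'
  · rcases identified_iff.1 h with ⟨-, h⟩ | ⟨z', -, -, h⟩
    · rw [h, Finset.card_singleton] at hzx
      omega
    · have := Finset.ext_iff.1 h x
      have := Finset.ext_iff.1 h z
      grind

theorem CanContract.symm {x y : V} (h : T.CanContract x y) (hxy : (oneSkeleton T.cx).Adj x y) :
    T.CanContract y x := by
  by_contra hn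
  obtain ⟨z, hz⟩ := exists_isSubdivision_of_not_canContract hxy.symm hn
  refine hz.2.2 ?_
  rw [Finset.insert_comm]
  exact h.mem_triangles hxy hz.adj.2.2 hz.adj.2.1

end Triangulation

/-! ### Areas -/

section Cross

/-- The determinant of two plane vectors, which vanishes if and only if they are parallel. -/
def cross {R : Type*} [CommRing R] (p q : Fin 2 → R) : R := p 0 * q 1 - p 1 * q 0

section CommRing

variable {R : Type*} [CommRing R]

theorem cross_comm (p q : Fin 2 → R) : cross p q = -cross q p := by
  simp only [cross]
  ring

theorem cross_self (p : Fin 2 → R) : cross p p = 0 := by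
  simp only [cross]
  ring

theorem zero_cross (p : Fin 2 → R) : cross 0 p = 0 := by
  simp [cross]

theorem cross_zero (p : Fin 2 → R) : cross p 0 = 0 := by
  simp [cross]

theorem cross_smul_smul (r s : R) (p : Fin 2 → R) : cross (r • p) (s • p) = 0 := by
  simp only [cross, Pi.smul_apply, smul_eq_mul]
  ring

theorem cross_eq_zero_comm {p q : Fin 2 → R} : cross p q = 0 ↔ cross q p = 0 := by
  rw [cross_comm, neg_eq_zero]

end CommRing

section Field

variable {K : Type*} [Field K] {p q r : Fin 2 → K}

theorem exists_smul_eq_of_cross_eq_zero (hp : p ≠ 0) (h : cross p q = 0) :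
    ∃ s : K, s • p = q := by
  have hdep : ¬ LinearIndependent K ![p, q] := fun hli => by
    have hunit := (Matrix.isUnit_iff_isUnit_det _).1
      (Matrix.linearIndependent_rows_iff_isUnit (A := Matrix.of ![p, q]).1 hli)
    refine hunit.ne_zero ?_
    rw [Matrix.det_fin_two, ← h]
    simp only [cross, Matrix.of_apply, Matrix.cons_val_zero, Matrix.cons_val_one]
  simpa only [LinearIndependent.pair_iff' hp, not_forall, not_not] using hdep

theorem cross_eq_zero_trans (hp : p ≠ 0) (h : cross p q = 0) (h' : cross p r = 0) :
    cross q r = 0 := by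
  obtain ⟨s, rfl⟩ := exists_smul_eq_of_cross_eq_zero hp h
  obtain ⟨t, rfl⟩ := exists_smul_eq_of_cross_eq_zero hp h'
  exact cross_smul_smul s t p

theorem collinear_iff_cross (P Q R : Fin 2 → K) :
    Collinear K {P, Q, R} ↔ cross (Q - P) (R - P) = 0 := by
  rw [collinear_iff_of_mem (p₀ := P) (by simp)]
  simp only [Set.mem_insert_iff, Set.mem_singleton_iff, forall_eq_or_imp, forall_eq, vadd_eq_add,
    ← sub_eq_iff_eq_add]
  constructor
  · rintro ⟨v, -, ⟨r, hr⟩, s, hs⟩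
    rw [hr, hs, cross_smul_smul]
  · intro h
    by_cases hQ : Q - P = 0
    · exact ⟨R - P, ⟨0, by simp⟩, ⟨0, by simp [hQ]⟩, 1, by simp⟩
    · obtain ⟨r, hr⟩ := exists_smul_eq_of_cross_eq_zero hQ h
      exact ⟨Q - P, ⟨0, by simp⟩, ⟨1, by simp⟩, r, hr.symm⟩

end Field

theorem triArea_eq_cross (P Q R : Fin 2 → ℂ) :
    triArea P Q R = 1 / 2 * cross (Q - P) (R - P) := by
  simp only [triArea, cross, Matrix.det_fin_three, Pi.sub_apply]
  simp
  ring

theorem triArea_eq_add (o P Q R : Fin 2 → ℂ) :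
    triArea P Q R = 1 / 2 * cross (P - o) (Q - o) + 1 / 2 * cross (Q - o) (R - o) +
      1 / 2 * cross (R - o) (P - o) := by
  rw [triArea_eq_cross]
  simp only [cross, Pi.sub_apply]
  ring

end Cross

namespace Triangulation

variable {V : Type u} [Fintype V] [DecidableEq V] {T : Triangulation V} {a b c : V}
  {t : Finset V}

/-- The directed edges of the triangle `t`, in the direction given by the orientation. -/
noncomputable def darts (T : Triangulation V) (t : Finset V) : Finset (V × V) :=
  open Classical in Finset.univ.filter fun d => ∃ c, T.pos d.1 d.2 c ∧ t = {d.1, d.2, c}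

theorem mem_darts : (a, b) ∈ T.darts t ↔ ∃ c, T.pos a b c ∧ t = {a, b, c} := by
  simp [darts]

theorem darts_of_pos (h : T.pos a b c) : T.darts {a, b, c} = {(a, b), (b, c), (c, a)} := by
  have hO := T.isOrientation
  ext ⟨x, y⟩
  simp only [mem_darts, Finset.mem_insert, Finset.mem_singleton, Prod.mk.injEq]
  constructor
  · rintro ⟨z, hz, he⟩
    have hne := hO.ne_left hz
    have asymm : ∀ {u v w}, T.pos u v w → ∀ w', T.pos v u w' →
        {u, v, w} ≠ ({v, u, w'} : Finset V) :=
      fun {u v w} huvw w' hvuw' heq => by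
        have : w' = w := by
          have h₁ : w' ∈ ({u, v, w} : Finset V) := heq ▸ by simp
          have := hO.ne_right hvuw'
          have := hO.ne_outer hvuw'
          grind
        exact hO.asymm huvw (this ▸ hvuw')
    have hx : x ∈ ({a, b, c} : Finset V) := he ▸ by simp
    have hy : y ∈ ({a, b, c} : Finset V) := he ▸ by simp
    have habc : ({b, c, a} : Finset V) = {a, b, c} := by grind
    have hcab : ({c, a, b} : Finset V) = {a, b, c} := by grind
    have := asymm h
    have h₂ := asymm (hO.rotate h)
    have h₃ := asymm (hO.rotate_right h)
    rw [habc] at h₂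
    rw [hcab] at h₃
    grind
  · rintro (⟨rfl, rfl⟩ | ⟨rfl, rfl⟩ | ⟨rfl, rfl⟩)
    · exact ⟨c, h, rfl⟩
    · exact ⟨a, hO.rotate h, by grind⟩
    · exact ⟨b, hO.rotate_right h, by grind⟩

theorem pairwiseDisjoint_darts (I : Set (Finset V)) : I.PairwiseDisjoint T.darts := by
  refine fun t _ t' _ hne => Finset.disjoint_left.2 ?_
  rintro ⟨a, b⟩ h h'
  obtain ⟨c, hc, rfl⟩ := mem_darts.1 h
  obtain ⟨c', hc', rfl⟩ := mem_darts.1 h'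
  exact hne (T.pos_coherent _ _ _ _ hc hc' ▸ rfl)

end Triangulation

namespace Drawing

open Triangulation

variable {V : Type u} [Fintype V] [DecidableEq V] {T : Triangulation V} {ρ : Drawing T}
  {a b c : V} {t : Finset V}

theorem nondegenerate_subset (ρ : Drawing T) : ρ.nondegenerate ⊆ triangles T.cx := by
  classical
  exact Finset.filter_subset _ _

theorem mem_nondegenerate : {a, b, c} ∈ ρ.nondegenerate ↔ {a, b, c} ∈ triangles T.cx ∧
    cross (ρ.toFun b - ρ.toFun a) (ρ.toFun c - ρ.toFun a) ≠ 0 := by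
  have himage : ρ.toFun '' (({a, b, c} : Finset V) : Set V) =
      {ρ.toFun a, ρ.toFun b, ρ.toFun c} := by
    simp [Set.image_insert_eq]
  classical
  rw [nondegenerate, Finset.mem_filter, himage, collinear_iff_cross]

theorem cross_eq_zero_of_notMem (ht : {a, b, c} ∈ triangles T.cx)
    (h : {a, b, c} ∉ ρ.nondegenerate) :
    cross (ρ.toFun b - ρ.toFun a) (ρ.toFun c - ρ.toFun a) = 0 :=
  not_not.1 fun hne => h (mem_nondegenerate.2 ⟨ht, hne⟩)

theorem area_eq_zero (ht : t ∈ triangles T.cx) (h : t ∉ ρ.nondegenerate) : ρ.area t = 0 := by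
  obtain ⟨a, b, c, hp, rfl⟩ := T.isOrientation.exists_pos ht
  rw [area_eq ρ hp, triArea_eq_cross, cross_eq_zero_of_notMem ht h, mul_zero]

theorem area_eq_sum_darts (ρ : Drawing T) (o : Fin 2 → ℂ) (ht : t ∈ triangles T.cx) :
    ρ.area t = ∑ d ∈ T.darts t, 1 / 2 * cross (ρ.toFun d.1 - o) (ρ.toFun d.2 - o) := by
  obtain ⟨a, b, c, hp, rfl⟩ := T.isOrientation.exists_pos ht
  have hab := T.isOrientation.ne_left hp
  have hbc := T.isOrientation.ne_right hp
  rw [area_eq ρ hp, triArea_eq_add o, darts_of_pos hp, Finset.sum_insert (by grind),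
    Finset.sum_pair (by grind), add_assoc]

/-- Writing each area as a sum over directed edges, opposite directed edges cancel. -/
theorem sum_area_eq_zero (ρ : Drawing T) {I : Finset (Finset V)} (hI : I ⊆ triangles T.cx)
    (o : Fin 2 → ℂ)
    (h : ∀ a b c, T.pos a b c → {a, b, c} ∈ I → cross (ρ.toFun a - o) (ρ.toFun b - o) ≠ 0 →
      ∃ d, T.pos b a d ∧ {b, a, d} ∈ I) :
    ∑ t ∈ I, ρ.area t = 0 := by
  rw [Finset.sum_congr rfl fun t ht => ρ.area_eq_sum_darts o (hI ht),
    ← Finset.sum_biUnion (pairwiseDisjoint_darts _), ← Finset.sum_filter_ne_zero]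
  have hcross : ∀ {d : V × V}, 1 / 2 * cross (ρ.toFun d.1 - o) (ρ.toFun d.2 - o) ≠ 0 ↔
      cross (ρ.toFun d.1 - o) (ρ.toFun d.2 - o) ≠ 0 := by
    simp
  refine Finset.sum_involution (fun d _ => d.swap) (fun d _ => ?_) (fun d _ hd => ?_)
    (fun d hd => ?_) fun d _ => d.swap_swap
  · rw [cross_comm, Prod.fst_swap, Prod.snd_swap, mul_neg, neg_add_cancel]
  · rintro heq
    exact hcross.1 hd (by rw [← Prod.snd_swap, heq, cross_self])
  · obtain ⟨a, b⟩ := d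
    simp only [Finset.mem_filter, Finset.mem_biUnion, hcross, mem_darts, Prod.swap_prod_mk] at hd ⊢
    obtain ⟨⟨t, ht, c, hc, rfl⟩, hne⟩ := hd
    obtain ⟨d, hd, hdI⟩ := h a b c hc ht hne
    exact ⟨⟨_, hdI, d, hd, rfl⟩, mt cross_eq_zero_comm.1 hne⟩

theorem NoZeroSum.notMem_nondegenerate (hρ : ρ.NoZeroSum) {I : Finset (Finset V)}
    (hI : I ⊆ triangles T.cx) (h : ∑ t ∈ I, ρ.area t = 0) (ht : t ∈ I) :
    t ∉ ρ.nondegenerate := by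
  intro hn
  refine hρ (I ∩ ρ.nondegenerate) Finset.inter_subset_right
    ⟨t, Finset.mem_inter.2 ⟨ht, hn⟩⟩ ?_
  rw [← h]
  refine Finset.sum_subset Finset.inter_subset_left fun s hs hs' => ?_
  exact area_eq_zero (hI hs) fun h => hs' (Finset.mem_inter.2 ⟨hs, h⟩)

theorem NoZeroSum.not_isInside (hρ : ρ.NoZeroSum) {x y z : V} (hxy : ρ.toFun x = ρ.toFun y)
    (ht : t ∈ ρ.nondegenerate) : ¬ T.IsInside {x, y, z} t := by
  classical
  intro hin
  refine hρ.notMem_nondegenerate (I := (triangles T.cx).filter fun t => T.IsInside {x, y, z} t)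
    (Finset.filter_subset _ _) ?_ (Finset.mem_filter.2 ⟨hin.1, hin⟩) ht
  refine sum_area_eq_zero ρ (Finset.filter_subset _ _) (ρ.toFun x) fun a b c hp hI hne => ?_
  have hin_abc := (Finset.mem_filter.1 hI).2
  have hab := T.isOrientation.ne_left hp
  have ne_base : ∀ {u}, ρ.toFun u - ρ.toFun x ≠ 0 → u ≠ x ∧ u ≠ y := fun hu =>
    ⟨fun h => hu (by rw [h, sub_self]), fun h => hu (by rw [h, hxy, sub_self])⟩
  have ha := ne_base (u := a) fun h => hne (by rw [h, zero_cross])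
  have hb := ne_base (u := b) fun h => hne (by rw [h, cross_zero])
  have hnS : ¬ ({a, b} : Finset V) ⊆ {x, y, z} := by
    simp only [Finset.insert_subset_iff, Finset.singleton_subset_iff, Finset.mem_insert,
      Finset.mem_singleton]
    grind
  have hsub : ∀ {d}, ({a, b} : Finset V) ⊆ {a, b, d} := by grind
  obtain ⟨d, hd⟩ : IsDart T.pos b a := by
    by_contra hn
    exact hin_abc.2 ⟨_, .refl, {a, b}, T.isOrientation.isBoundaryEdge_iff.2 (.inl ⟨⟨c, hp⟩, hn⟩),
      hsub, hnS⟩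
  have htri := T.pos_triangle _ _ _ hd
  refine ⟨d, hd, Finset.mem_filter.2 ⟨htri, CrossAdj.isInside ?_ hin_abc⟩⟩
  exact ⟨hin_abc.1, htri, {a, b}, isEdge_of_subset hin_abc.1 hsub (Finset.card_pair hab), hsub,
    by grind, hnS⟩

theorem corner_add_corner (ρ : Drawing T) (i : Fin 4) :
    ρ.toFun (T.corner i) + ρ.toFun (T.corner (i + 2)) =
      ρ.toFun (T.corner (i + 1)) + ρ.toFun (T.corner (i + 3)) := by
  have h := ρ.parallelogram
  fin_cases i
  · exact h
  · exact h.symm.trans (add_comm _ _)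
  · exact (add_comm _ _).trans (h.trans (add_comm _ _))
  · exact (add_comm _ _).trans h.symm

theorem NoZeroSum.cross_corner_ne_zero (hρ : ρ.NoZeroSum) (hne : ρ.nondegenerate.Nonempty)
    (i : Fin 4) : cross (ρ.toFun (T.corner (i + 1)) - ρ.toFun (T.corner i))
      (ρ.toFun (T.corner (i + 3)) - ρ.toFun (T.corner i)) ≠ 0 := by
  intro h0
  obtain ⟨t, ht⟩ := hne
  refine hρ.notMem_nondegenerate subset_rfl ?_ (ρ.nondegenerate_subset ht) ht
  refine sum_area_eq_zero ρ subset_rfl (ρ.toFun (T.corner i)) fun a b c hp _ hne => ?_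
  by_contra! hno
  obtain ⟨j, rfl, rfl⟩ := exists_corner_of_isDart ⟨c, hp⟩
    fun ⟨d, hd⟩ => hno d hd (T.pos_triangle _ _ _ hd)
  obtain ⟨k, rfl⟩ : ∃ k, j = i + k := ⟨j - i, (add_sub_cancel i j).symm⟩
  have opposite : ρ.toFun (T.corner (i + 2)) =
      ρ.toFun (T.corner (i + 1)) + ρ.toFun (T.corner (i + 3)) - ρ.toFun (T.corner i) :=
    eq_sub_of_add_eq' (ρ.corner_add_corner i)
  refine hne ?_
  rw [add_assoc]
  fin_cases k <;> simp only [Fin.reduceFinMk, Fin.isValue, Fin.reduceAdd, Fin.mk_one,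
    Fin.zero_eta, add_zero, zero_add, sub_self, zero_cross, cross_zero, opposite]
  all_goals
    simp only [cross, Pi.add_apply, Pi.sub_apply] at h0 ⊢
    linear_combination h0

/-! ### The size of simple drawings -/

theorem IsSimple.toFun_ne (hs : ρ.IsSimple) (hρ : ρ.NoZeroSum)
    (hne : ρ.nondegenerate.Nonempty) {x y : V} (hxy : (oneSkeleton T.cx).Adj x y) :
    ρ.toFun x ≠ ρ.toFun y := by
  intro he
  by_cases hb : IsBoundaryEdge T.cx {x, y}
  · have corner_ne : ∀ a b, IsDart T.pos a b → ¬ IsDart T.pos b a →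
        ρ.toFun a ≠ ρ.toFun b := by
      intro a b h h' heq
      obtain ⟨i, rfl, rfl⟩ := exists_corner_of_isDart h h'
      exact hρ.cross_corner_ne_zero hne i (by rw [heq, sub_self, zero_cross])
    rcases T.isOrientation.isBoundaryEdge_iff.1 hb with h | h
    · exact corner_ne x y h.1 h.2 he
    · exact corner_ne y x h.1 h.2 he.symm
  · have hc : ¬ T.CanContract x y := fun h =>
      hs.elastic ⟨x, y, ⟨isEdge_pair_iff.2 hxy, hb⟩, he, h⟩
    obtain ⟨z, hz⟩ := exists_isSubdivision_of_not_canContract hxy hc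
    obtain ⟨t, ht, hin⟩ := hs.subdivision _ hz
    exact hρ.not_isInside he ht hin

theorem IsSimple.cross_eq_zero_of_notMem (hs : ρ.IsSimple) (hρ : ρ.NoZeroSum)
    (hne : ρ.nondegenerate.Nonempty) {v : V} (ht : {v, a, b} ∈ triangles T.cx)
    (hn : {v, a, b} ∉ ρ.nondegenerate) {q : Fin 2 → ℂ} (hq : cross q (ρ.toFun a - ρ.toFun v) = 0) :
    cross q (ρ.toFun b - ρ.toFun v) = 0 := by
  have hO := T.isOrientation
  have hva : (oneSkeleton T.cx).Adj v a :=
    (hO.pos_or_pos ht).elim hO.adj_left fun h => (hO.adj_left h).symm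
  exact cross_eq_zero_trans (sub_ne_zero.2 (hs.toFun_ne hρ hne hva.symm))
    (cross_eq_zero_comm.1 hq) (Drawing.cross_eq_zero_of_notMem ht hn)

/-- If `vab` were the only nondegenerate triangle at `v`, going around `v` from `b` to `a` through
degenerate triangles would show that `a` lies on the line through `v` and `b`. -/
theorem IsSimple.two_le_card_filter_mem (hs : ρ.IsSimple) (hρ : ρ.NoZeroSum)
    (hne : ρ.nondegenerate.Nonempty) {v : V} (hv : ∀ i, v ≠ T.corner i) :
    2 ≤ (ρ.nondegenerate.filter fun t => v ∈ t).card := by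
  have hO := T.isOrientation
  obtain ⟨t, ht, hvt⟩ := hs.interior v (mem_interiorVertices.2 hv)
  by_contra! hlt
  have hone := Finset.card_le_one.1 (Nat.lt_succ_iff.1 hlt)
  obtain ⟨a, b, hp, rfl⟩ := hO.exists_pos_of_mem (ρ.nondegenerate_subset ht) hvt
  have hab : cross (ρ.toFun b - ρ.toFun v) (ρ.toFun a - ρ.toFun v) ≠ 0 :=
    mt cross_eq_zero_comm.1 (mem_nondegenerate.1 ht).2
  refine hab (cyclic_link_induction (P := fun c =>
    cross (ρ.toFun b - ρ.toFun v) (ρ.toFun c - ρ.toFun v) = 0) hv (hO.adj_outer hp) (cross_self _)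
    (fun c d hcd hc => ?_) (hO.adj_left hp))
  have hca : c ≠ a := by
    rintro rfl
    exact hab hc
  refine hs.cross_eq_zero_of_notMem hρ hne (T.pos_triangle _ _ _ hcd) (fun hn => ?_) hc
  have heq : ({v, c, d} : Finset V) = {v, a, b} := hone _ (Finset.mem_filter.2 ⟨hn, by simp⟩) _
    (Finset.mem_filter.2 ⟨ht, by simp⟩)
  have ha : a ∈ ({v, c, d} : Finset V) := heq ▸ by simp
  have hc' : c ∈ ({v, a, b} : Finset V) := heq ▸ by simp
  have hva := hO.ne_left hp
  have hvc := hO.ne_left hcd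
  obtain rfl : c = b := by grind
  obtain rfl : a = d := by grind
  exact hO.asymm hp (hO.rotate_right hcd)

theorem IsSimple.nonempty_filter_corner_mem (hs : ρ.IsSimple) (hρ : ρ.NoZeroSum)
    (hne : ρ.nondegenerate.Nonempty) (i : Fin 4) :
    (ρ.nondegenerate.filter fun t => T.corner i ∈ t).Nonempty := by
  by_contra! hempty
  have hO := T.isOrientation
  have hdeg : ∀ a b, {T.corner i, a, b} ∉ ρ.nondegenerate := fun a b h =>
    Finset.filter_eq_empty_iff.1 hempty h (Finset.mem_insert_self _ _)
  have hprev : (oneSkeleton T.cx).Adj (T.corner i) (T.corner (i + 3)) := by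
    have := (hO.adj_of_isDart (T.corner_pos (i + 3))).symm
    rwa [add_assoc, show (3 + 1 : Fin 4) = 0 from rfl, add_zero] at this
  refine hρ.cross_corner_ne_zero hne i (T.isDisk.link_induction (P := fun c =>
    cross (ρ.toFun (T.corner (i + 1)) - ρ.toFun (T.corner i))
      (ρ.toFun c - ρ.toFun (T.corner i)) = 0) (hO.adj_of_isDart (T.corner_pos i)) (cross_self _)
    (fun a b h hP => hs.cross_eq_zero_of_notMem hρ hne h (hdeg a b) hP) hprev)

theorem IsSimple.two_mul_card_interiorVertices_add_four_le (hs : ρ.IsSimple)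
    (hρ : ρ.NoZeroSum) (hne : ρ.nondegenerate.Nonempty) :
    2 * T.interiorVertices.card + 4 ≤ 3 * ρ.nondegenerate.card := by
  have double_count := Finset.sum_card_bipartiteAbove_eq_sum_card_bipartiteBelow
    (fun (v : V) (t : Finset V) => v ∈ t) (s := Finset.univ) (t := ρ.nondegenerate)
  have card_eq_three : ∀ t ∈ ρ.nondegenerate,
      (Finset.univ.bipartiteBelow (fun (v : V) (t : Finset V) => v ∈ t) t).card = 3 := by
    intro t ht
    rw [Finset.bipartiteBelow, Finset.filter_univ_mem]
    exact (mem_triangles.1 (ρ.nondegenerate_subset ht)).2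
  rw [Finset.sum_congr rfl card_eq_three, Finset.sum_const, smul_eq_mul,
    ← Finset.sum_compl_add_sum T.interiorVertices] at double_count
  have at_interior : T.interiorVertices.card • 2 ≤ ∑ v ∈ T.interiorVertices,
      (ρ.nondegenerate.bipartiteAbove (fun (v : V) (t : Finset V) => v ∈ t) v).card :=
    Finset.card_nsmul_le_sum _ _ _ fun v hv =>
      hs.two_le_card_filter_mem hρ hne (mem_interiorVertices.1 hv)
  have at_corner : T.interiorVerticesᶜ.card • 1 ≤ ∑ v ∈ T.interiorVerticesᶜ,
      (ρ.nondegenerate.bipartiteAbove (fun (v : V) (t : Finset V) => v ∈ t) v).card := by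
    refine Finset.card_nsmul_le_sum _ _ _ fun v hv => ?_
    simp only [Finset.mem_compl, mem_interiorVertices, not_forall, not_not] at hv
    obtain ⟨i, rfl⟩ := hv
    exact (hs.nonempty_filter_corner_mem hρ hne i).card_pos
  have hcard := T.card_interiorVertices
  have hcompl := Finset.card_compl T.interiorVertices
  rw [smul_eq_mul] at at_interior at_corner
  omega

end Drawing

/-! ### Contraction of an edge -/

section ContractMap

variable {V : Type u} [DecidableEq V] {x y : V} (hxy : x ≠ y)

/-- The map that renames `y` as `x`, on the vertices left after the contraction of an edge `xy`. -/
def contractMap (v : V) : {u : V // u ≠ y} :=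
  ⟨if v = y then x else v, by split_ifs <;> assumption⟩

theorem contractMap_coe (v : {u : V // u ≠ y}) : contractMap hxy v.1 = v :=
  Subtype.ext (if_neg v.2)

theorem contractMap_right : contractMap hxy y = ⟨x, hxy⟩ := Subtype.ext (if_pos rfl)

theorem contractMap_left : contractMap hxy x = ⟨x, hxy⟩ := contractMap_coe hxy ⟨x, hxy⟩

theorem contractMap_eq_iff {a b : V} :
    contractMap hxy a = contractMap hxy b ↔ a = b ∨ (a = x ∧ b = y) ∨ (a = y ∧ b = x) := by
  simp only [contractMap, Subtype.mk.injEq]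
  grind

theorem contractMap_eq_left_iff {a : V} : contractMap hxy a = ⟨x, hxy⟩ ↔ a = x ∨ a = y := by
  rw [← contractMap_left hxy, contractMap_eq_iff]
  grind

theorem contractMap_injOn {t : Finset V} (h : ¬ {x, y} ⊆ t) : Set.InjOn (contractMap hxy) t := by
  intro a ha b hb hab
  have := (contractMap_eq_iff hxy).1 hab
  simp only [Finset.mem_coe] at ha hb
  grind

theorem contractMap_eq_of_subset {v a b : V} (hvx : v ≠ x) (hvy : v ≠ y)
    (hs : {x, y} ⊆ ({v, a, b} : Finset V)) : contractMap hxy a = contractMap hxy b := by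
  have hx := hs (Finset.mem_insert_self x _)
  have hy := hs (Finset.mem_insert_of_mem (Finset.mem_singleton_self y))
  simp only [Finset.mem_insert, Finset.mem_singleton] at hx hy
  rw [contractMap_eq_iff]
  grind only

end ContractMap

namespace Triangulation

variable {V : Type u} [Fintype V] [DecidableEq V] {T : Triangulation V} {x y : V}

/-- The complex obtained by contracting the edge `xy` to `x`. -/
def contractCx (T : Triangulation V) {x y : V} (hxy : x ≠ y) :
    AbstractSimplicialComplex {u : V // u ≠ y} :=
  (T.cx.toPreAbstractSimplicialComplex.map (contractMap hxy)).toAbstractSimplicialComplex _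
    fun v => ⟨{v.1}, T.cx.singleton_mem v.1, by simp [contractMap_coe]⟩

section ContractCx

variable (hxy : x ≠ y)

theorem mem_contractCx {s : Finset {u : V // u ≠ y}} :
    s ∈ (T.contractCx hxy).faces ↔ ∃ s' ∈ T.cx.faces, s'.image (contractMap hxy) = s :=
  Iff.rfl

theorem pair_mem_contractCx_iff {a b : {u : V // u ≠ y}} :
    {a, b} ∈ (T.contractCx hxy).faces ↔
      ∃ a' b', {a', b'} ∈ T.cx.faces ∧ contractMap hxy a' = a ∧ contractMap hxy b' = b := by
  refine ⟨fun ⟨s, hs, (he : s.image _ = _)⟩ => ?_, fun ⟨a', b', h, ha, hb⟩ => ⟨_, h, ?_⟩⟩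
  · have exists_lift : ∀ u ∈ ({a, b} : Finset _), ∃ u' ∈ s, contractMap hxy u' = u :=
      fun u hu => Finset.mem_image.1 (he ▸ hu)
    obtain ⟨a', ha, rfl⟩ := exists_lift a (by simp)
    obtain ⟨b', hb, rfl⟩ := exists_lift b (by simp)
    exact ⟨a', b', mem_faces_of_subset hs (by grind) (by simp), rfl, rfl⟩
  · simp only [Finset.image_insert, Finset.image_singleton, ha, hb]

theorem oneSkeleton_contractCx_adj_iff {a b : {u : V // u ≠ y}} :
    (oneSkeleton (T.contractCx hxy)).Adj a b ↔ a ≠ b ∧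
      ∃ a' b', (oneSkeleton T.cx).Adj a' b' ∧ contractMap hxy a' = a ∧ contractMap hxy b' = b := by
  refine and_congr_right fun hab => (pair_mem_contractCx_iff hxy).trans ?_
  refine exists₂_congr fun a' b' => ⟨fun ⟨h, ha, hb⟩ => ⟨⟨?_, h⟩, ha, hb⟩, fun ⟨h, ha, hb⟩ =>
    ⟨h.2, ha, hb⟩⟩
  rintro rfl
  exact hab (ha.symm.trans hb)

theorem adj_contractMap {a b : V} (h : (oneSkeleton T.cx).Adj a b)
    (hne : contractMap hxy a ≠ contractMap hxy b) :
    (oneSkeleton (T.contractCx hxy)).Adj (contractMap hxy a) (contractMap hxy b) :=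
  (oneSkeleton_contractCx_adj_iff hxy).2 ⟨hne, a, b, h, rfl, rfl⟩

theorem mem_triangles_contractCx {t : Finset {u : V // u ≠ y}} :
    t ∈ triangles (T.contractCx hxy) ↔
      ∃ s ∈ triangles T.cx, ¬ {x, y} ⊆ s ∧ s.image (contractMap hxy) = t := by
  rw [mem_triangles, mem_contractCx]
  constructor
  · rintro ⟨⟨s, hs, rfl⟩, hcard⟩
    have hs3 : s.card = 3 :=
      (T.isDisk.card_le s hs).antisymm (hcard ▸ Finset.card_image_le)
    refine ⟨s, mem_triangles.2 ⟨hs, hs3⟩, fun h => ?_, rfl⟩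
    have hinj := Finset.card_image_iff.1 (hcard.trans hs3.symm)
    exact hxy (hinj (h (by simp)) (h (by simp))
      ((contractMap_left hxy).trans (contractMap_right hxy).symm))
  · rintro ⟨s, hs, h, rfl⟩
    rw [mem_triangles] at hs
    exact ⟨⟨s, hs.1, rfl⟩, by rw [Finset.card_image_of_injOn (contractMap_injOn hxy h), hs.2]⟩

theorem triple_mem_triangles_contractCx {a b c : V} (h : {a, b, c} ∈ triangles T.cx)
    (hn : ¬ {x, y} ⊆ ({a, b, c} : Finset V)) :
    {contractMap hxy a, contractMap hxy b, contractMap hxy c} ∈ triangles (T.contractCx hxy) :=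
  (mem_triangles_contractCx hxy).2
    ⟨_, h, hn, by simp only [Finset.image_insert, Finset.image_singleton]⟩

theorem CanContract.image_injOn (h : T.CanContract x y) {s s' : Finset V}
    (hs : s ∈ triangles T.cx) (hs' : s' ∈ triangles T.cx) (hn : ¬ {x, y} ⊆ s)
    (hn' : ¬ {x, y} ⊆ s') (he : s.image (contractMap hxy) = s'.image (contractMap hxy)) :
    s = s' := by
  rw [SquareDrawing.mem_triangles] at hs hs'
  have not_identified : ∀ s s' : Finset V, s.card = 3 → ¬ T.Identified x y s s' := by
    intro s s' hcard hid
    rcases identified_iff.1 hid with ⟨rfl, -⟩ | ⟨z, -, rfl, -⟩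
    · simp at hcard
    · have := Finset.card_le_two (a := z) (b := x)
      omega
  have himage := congrArg (Finset.image Subtype.val) he
  simp only [Finset.image_image] at himage
  exact (h s hs.1 s' hs'.1 hn hn' himage).resolve_right
    (not_or.2 ⟨not_identified _ _ hs.2, not_identified _ _ hs'.2⟩)

end ContractCx

/-- The edge `xy` can be contracted to `x` without moving the corners. -/
structure IsContractible (T : Triangulation V) (x y : V) : Prop where
  adj : (oneSkeleton T.cx).Adj x y
  ne_corner : ∀ i, y ≠ T.corner i
  canContract : T.CanContract x y

/-- The cyclic order of the vertices in the triangles of the contracted complex. -/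
def contractPos (T : Triangulation V) {x y : V} (hxy : x ≠ y) (a b c : {u : V // u ≠ y}) : Prop :=
  ∃ a' b' c', T.pos a' b' c' ∧ ¬ {x, y} ⊆ ({a', b', c'} : Finset V) ∧
    contractMap hxy a' = a ∧ contractMap hxy b' = b ∧ contractMap hxy c' = c

theorem contractPos_of_pos (hxy : x ≠ y) {a b c : V} (h : T.pos a b c)
    (hn : ¬ {x, y} ⊆ ({a, b, c} : Finset V)) :
    T.contractPos hxy (contractMap hxy a) (contractMap hxy b) (contractMap hxy c) :=
  ⟨a, b, c, h, hn, rfl, rfl, rfl⟩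

theorem mem_triangles_of_contractPos (hxy : x ≠ y) {a b c : {u : V // u ≠ y}}
    (h : T.contractPos hxy a b c) : {a, b, c} ∈ triangles (T.contractCx hxy) := by
  obtain ⟨a, b, c, hp, hn, rfl, rfl, rfl⟩ := h
  exact triple_mem_triangles_contractCx hxy (T.pos_triangle _ _ _ hp) hn

theorem contractPos_rotate (hxy : x ≠ y) {a b c : {u : V // u ≠ y}}
    (h : T.contractPos hxy a b c) : T.contractPos hxy b c a := by
  obtain ⟨a', b', c', hp, hn, ha, hb, hc⟩ := h
  exact ⟨b', c', a', T.pos_rotate _ _ _ hp, by grind, hb, hc, ha⟩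

theorem contractPos_or_contractPos (hxy : x ≠ y) {a b c : {u : V // u ≠ y}}
    (ht : {a, b, c} ∈ triangles (T.contractCx hxy)) :
    T.contractPos hxy a b c ∨ T.contractPos hxy b a c := by
  obtain ⟨s, hs, hn, he⟩ := (mem_triangles_contractCx hxy).1 ht
  obtain ⟨a', ha', rfl⟩ := Finset.mem_image.1 (show a ∈ s.image (contractMap hxy) by simp [he])
  obtain ⟨b', c', hp, rfl⟩ := T.isOrientation.exists_pos_of_mem hs ha'
  have hpos := contractPos_of_pos hxy hp hn
  simp only [Finset.image_insert, Finset.image_singleton] at he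
  generalize contractMap hxy a' = a, contractMap hxy b' = b', contractMap hxy c' = c' at *
  have hcard := (mem_triangles.1 ht).2
  obtain ⟨hab, hac, hbc⟩ := Finset.card_triple_eq_three_iff.1 hcard
  have hb : b = b' ∨ b = c' := by simpa [hab.symm] using he.symm.subset (by simp : b ∈ _)
  have hc : c = b' ∨ c = c' := by simpa [hac.symm] using he.symm.subset (by simp : c ∈ _)
  have : (b' = b ∧ c' = c) ∨ (b' = c ∧ c' = b) := by grind only
  rcases this with ⟨rfl, rfl⟩ | ⟨rfl, rfl⟩
  · exact .inl hpos
  · exact .inr (contractPos_rotate hxy (contractPos_rotate hxy hpos))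

namespace IsContractible

variable (h : T.IsContractible x y)

include h

theorem contractPos_asymm {a b c : {u : V // u ≠ y}} (habc : T.contractPos h.adj.1 a b c) :
    ¬ T.contractPos h.adj.1 b a c := by
  obtain ⟨a, b, c, hp, hn, rfl, rfl, rfl⟩ := habc
  rintro ⟨b', a', c', hp', hn', hb, ha, hc⟩
  have he := h.canContract.image_injOn h.adj.1 (T.pos_triangle _ _ _ hp')
    (T.pos_triangle _ _ _ hp) hn' hn (by
      simp only [Finset.image_insert, Finset.image_singleton, ha, hb, hc]
      exact Finset.insert_comm _ _ _)
  have hinj := contractMap_injOn h.adj.1 hn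
  obtain rfl : a' = a := hinj (by rw [← he]; simp) (by simp) ha
  obtain rfl : b' = b := hinj (by rw [← he]; simp) (by simp) hb
  obtain rfl : c' = c := hinj (by rw [← he]; simp) (by simp) hc
  exact T.isOrientation.asymm hp hp'

theorem pos_of_pos_right {b c : V} (hp : T.pos y b c) (hc : c ≠ x)
    (hxb : (oneSkeleton T.cx).Adj x b) : T.pos x b y := by
  have o := T.isOrientation
  rcases o.pos_or_pos (h.canContract.mem_triangles h.adj hxb (o.adj_left hp)) with hp' | hp'
  · exact absurd (o.coherent hp (o.rotate hp')) hc
  · exact o.rotate_right (o.rotate_right hp')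

theorem pos_of_pos_left {a c : V} (hp : T.pos a y c) (hc : c ≠ x)
    (hxa : (oneSkeleton T.cx).Adj x a) : T.pos a x y := by
  have o := T.isOrientation
  rcases o.pos_or_pos (h.canContract.mem_triangles h.adj hxa (o.adj_left hp).symm) with hp' | hp'
  · exact o.rotate_right hp'
  · exact absurd (o.coherent hp (o.rotate_right hp')) hc

theorem contractPos_coherent {a b c d : {u : V // u ≠ y}} (hc : T.contractPos h.adj.1 a b c)
    (hd : T.contractPos h.adj.1 a b d) : c = d := by
  have o := T.isOrientation
  obtain ⟨a, b, c, hp, hn, rfl, rfl, rfl⟩ := hc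
  obtain ⟨a', b', d, hp', hn', ha, hb, rfl⟩ := hd
  have not_first : ∀ {b c d}, T.pos x b c → T.pos y b d → c ≠ y → d ≠ x → False :=
    fun h₁ h₂ hc hd => hc (o.coherent h₁ (h.pos_of_pos_right h₂ hd (o.adj_left h₁)))
  have not_second : ∀ {a c d}, T.pos a x c → T.pos a y d → c ≠ y → d ≠ x → False :=
    fun h₁ h₂ hc hd => hc (o.coherent h₁ (h.pos_of_pos_left h₂ hd (o.adj_left h₁).symm))
  rw [contractMap_eq_iff] at ha hb
  rcases ha with rfl | ⟨rfl, rfl⟩ | ⟨rfl, rfl⟩ <;> rcases hb with rfl | ⟨rfl, rfl⟩ | ⟨rfl, rfl⟩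
  · rw [o.coherent hp hp']
  · exact (not_second hp' hp (by grind) (by grind)).elim
  · exact (not_second hp hp' (by grind) (by grind)).elim
  · exact (not_first hp' hp (by grind) (by grind)).elim
  · exact absurd rfl (o.ne_left hp)
  · exact absurd (by grind) hn
  · exact (not_first hp hp' (by grind) (by grind)).elim
  · exact absurd (by grind) hn
  · exact absurd rfl (o.ne_left hp)

theorem isOrientation : IsOrientation (T.contractCx h.adj.1) (T.contractPos h.adj.1) where
  mem_triangles := mem_triangles_of_contractPos _
  rotate := contractPos_rotate _
  xor ht := (contractPos_or_contractPos _ ht).imp (fun hp => ⟨hp, h.contractPos_asymm hp⟩)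
    fun hp => ⟨hp, h.contractPos_asymm hp⟩
  coherent := h.contractPos_coherent

theorem isDart_of_isDart_contractPos {a b : {u : V // u ≠ y}}
    (hab : (oneSkeleton T.cx).Adj a.1 b.1) (hd : IsDart (T.contractPos h.adj.1) a b) :
    IsDart T.pos a.1 b.1 := by
  obtain ⟨c, a', b', c', hp, hn, ha, hb, -⟩ := hd
  rw [← contractMap_coe h.adj.1 a, contractMap_eq_iff] at ha
  rw [← contractMap_coe h.adj.1 b, contractMap_eq_iff] at hb
  have ha' := a.2
  have hb' := b.2
  rcases ha with rfl | ⟨-, ha⟩ | ⟨rfl, hax⟩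
  · rcases hb with rfl | ⟨-, hb⟩ | ⟨rfl, hbx⟩
    · exact ⟨c', hp⟩
    · exact absurd hb hb'
    · rw [hbx] at hab ⊢
      exact ⟨_, h.pos_of_pos_left hp (by grind) hab.symm⟩
  · exact absurd ha ha'
  · rcases hb with rfl | ⟨-, hb⟩ | ⟨rfl, -⟩
    · rw [hax] at hab ⊢
      exact ⟨_, h.pos_of_pos_right hp (by grind) hab⟩
    · exact absurd hb hb'
    · exact absurd rfl (T.isOrientation.ne_left hp)

/-- If the triangle on `ab` collapses, it is replaced by the next triangle around `y`. -/
theorem isDart_contractPos_of_isDart {a b : {u : V // u ≠ y}} (hd : IsDart T.pos a.1 b.1) :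
    IsDart (T.contractPos h.adj.1) a b := by
  have o := T.isOrientation
  obtain ⟨c, hp⟩ := hd
  have ha := contractMap_coe h.adj.1 a
  have hb := contractMap_coe h.adj.1 b
  by_cases hn : {x, y} ⊆ ({a.1, b.1, c} : Finset V)
  · have ha' := a.2
    have hb' := b.2
    have hxy := h.adj.1
    simp only [Finset.insert_subset_iff, Finset.singleton_subset_iff, Finset.mem_insert,
      Finset.mem_singleton] at hn
    obtain ⟨rfl, hx⟩ : c = y ∧ (a.1 = x ∨ b.1 = x) := by grind only
    rcases hx with hx | hx
    · rw [hx] at hp ha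
      obtain ⟨e, he⟩ := (isDart_and_isDart_of_adj (o.adj_left (o.rotate hp)).symm h.ne_corner).1
      have hex : e ≠ x := by
        rintro rfl
        exact o.asymm (o.rotate hp) he
      have hxb := o.ne_left hp
      have := contractPos_of_pos hxy he fun hs =>
        absurd (hs (Finset.mem_insert_self x _)) (by simp [hxy, hxb, hex.symm])
      rw [contractMap_right, ← contractMap_left h.adj.1, ha, hb] at this
      exact ⟨_, this⟩
    · rw [hx] at hp hb
      obtain ⟨e, he⟩ := (isDart_and_isDart_of_adj (o.adj_outer hp).symm h.ne_corner).2
      have hex : e ≠ x := by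
        rintro rfl
        exact o.asymm he (o.rotate_right hp)
      have hxa := o.ne_left hp
      have := contractPos_of_pos hxy he fun hs =>
        absurd (hs (Finset.mem_insert_self x _)) (by simp [hxy, hxa.symm, hex.symm])
      rw [contractMap_right, ← contractMap_left h.adj.1, ha, hb] at this
      exact ⟨_, this⟩
  · have := contractPos_of_pos h.adj.1 hp hn
    rw [ha, hb] at this
    exact ⟨_, this⟩

theorem isDart_contractPos_iff {a b : {u : V // u ≠ y}}
    (hab : (oneSkeleton T.cx).Adj a.1 b.1) :
    IsDart (T.contractPos h.adj.1) a b ↔ IsDart T.pos a.1 b.1 :=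
  ⟨h.isDart_of_isDart_contractPos hab, h.isDart_contractPos_of_isDart⟩

theorem isDart_contractPos_of_not_adj {a b : {u : V // u ≠ y}}
    (hab : (oneSkeleton (T.contractCx h.adj.1)).Adj a b)
    (hn : ¬ (oneSkeleton T.cx).Adj a.1 b.1) : IsDart (T.contractPos h.adj.1) a b := by
  have o := T.isOrientation
  obtain ⟨-, a', b', hab', rfl, rfl⟩ := (oneSkeleton_contractCx_adj_iff h.adj.1).1 hab
  simp only [contractMap] at hn
  have hd : IsDart T.pos a' b' := by
    by_cases hay : a' = y
    · exact (isDart_and_isDart_of_adj hab' (hay ▸ h.ne_corner)).1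
    · by_cases hby : b' = y
      · exact (isDart_and_isDart_of_adj hab'.symm (hby ▸ h.ne_corner)).2
      · exact absurd hab' (by simpa only [hay, hby, if_false] using hn)
  obtain ⟨c, hp⟩ := hd
  refine ⟨_, contractPos_of_pos h.adj.1 hp fun hs => hn ?_⟩
  have hne := mt (contractMap_eq_iff h.adj.1).2 hab.1
  have := h.adj.1
  simp only [Finset.insert_subset_iff, Finset.singleton_subset_iff, Finset.mem_insert,
    Finset.mem_singleton] at hs
  have hac := o.adj_outer hp
  have hbc := (o.adj_left (o.rotate hp)).symm
  split_ifs <;> grind only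

theorem isBoundaryEdge_contractCx_iff {e : Finset {u : V // u ≠ y}} :
    IsBoundaryEdge (T.contractCx h.adj.1) e ↔ IsBoundaryEdge T.cx (e.image Subtype.val) := by
  by_cases hcard : e.card = 2
  · obtain ⟨a, b, -, rfl⟩ := Finset.card_eq_two.1 hcard
    simp only [Finset.image_insert, Finset.image_singleton]
    rw [h.isOrientation.isBoundaryEdge_iff, T.isOrientation.isBoundaryEdge_iff]
    by_cases hadj : (oneSkeleton T.cx).Adj a.1 b.1
    · rw [h.isDart_contractPos_iff hadj, h.isDart_contractPos_iff hadj.symm]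
    · refine iff_of_false (fun hd => ?_) fun hd => hadj (adj_iff.2 hd.or)
      have hadj' : (oneSkeleton (T.contractCx h.adj.1)).Adj a b :=
        hd.or.elim h.isOrientation.adj_of_isDart fun hd => (h.isOrientation.adj_of_isDart hd).symm
      exact hd.elim
        (fun hd => hd.2 (h.isDart_contractPos_of_not_adj hadj'.symm fun h => hadj h.symm))
        fun hd => hd.2 (h.isDart_contractPos_of_not_adj hadj' hadj)
  · refine iff_of_false (fun he => hcard he.1.2) fun he => hcard ?_
    rw [← Finset.card_image_of_injective e Subtype.val_injective, he.1.2]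

/-- The corners of the contracted triangulation. -/
def contractCorner (i : Fin 4) : {u : V // u ≠ y} := ⟨T.corner i, (h.ne_corner i).symm⟩

theorem isBoundaryEdge_contractCx_iff_exists_corner {e : Finset {u : V // u ≠ y}} :
    IsBoundaryEdge (T.contractCx h.adj.1) e ↔
      ∃ i, e = {h.contractCorner i, h.contractCorner (i + 1)} := by
  rw [h.isBoundaryEdge_contractCx_iff, T.boundary_iff]
  refine exists_congr fun i => ?_
  rw [← (Finset.image_injective Subtype.val_injective).eq_iff]
  simp only [Finset.image_insert, Finset.image_singleton, contractCorner]

end IsContractible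
end Triangulation

section Homotopy

variable {V W : Type u} {K : AbstractSimplicialComplex V} {L : AbstractSimplicialComplex W}
  {l l' : List V}

theorem eqvGen_map {α β : Type*} {r : α → α → Prop} {s : β → β → Prop} (F : α → β)
    (hF : ∀ a b, r a b → s (F a) (F b)) {a b : α} (h : Relation.EqvGen r a b) :
    Relation.EqvGen s (F a) (F b) :=
  Quot.eqvGen_exact (congrArg (Quot.map F hF) (Quot.eqvGen_sound h))

theorem ElementaryHomotopy.cons [DecidableEq V] (v : V) (h : ElementaryHomotopy K l l') :
    ElementaryHomotopy K (v :: l) (v :: l') := by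
  obtain ⟨p, q, a, b, c, hf, rfl, rfl⟩ := h
  exact ⟨v :: p, q, a, b, c, hf, rfl, rfl⟩

theorem ElementaryHomotopy.map [DecidableEq V] [DecidableEq W] {f : V → W}
    (hf : ∀ s ∈ K.faces, s.image f ∈ L.faces) (h : ElementaryHomotopy K l l') :
    ElementaryHomotopy L (l.map f) (l'.map f) := by
  obtain ⟨p, q, a, b, c, hs, rfl, rfl⟩ := h
  refine ⟨p.map f, q.map f, f a, f b, f c, ?_, by simp, by simp⟩
  simpa only [Finset.image_insert, Finset.image_singleton] using hf _ hs

theorem isEdgePath_cons_cons [DecidableEq V] {a b : V} :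
    IsEdgePath K (a :: b :: l) ↔ {a, b} ∈ K.faces ∧ IsEdgePath K (b :: l) :=
  List.isChain_cons_cons

end Homotopy

theorem linkGraph_connected_of_induction {V : Type u} [Fintype V] [DecidableEq V]
    {K : AbstractSimplicialComplex V} {v a₀ : V} (h₀ : (oneSkeleton K).Adj v a₀)
    (h : ∀ P : V → Prop, P a₀ → (∀ a b, {v, a, b} ∈ triangles K → P a → P b) →
      ∀ a, (oneSkeleton K).Adj v a → P a) : (linkGraph K v).Connected := by
  have hreach := h (fun a => ∀ ha : (oneSkeleton K).Adj v a,
    (linkGraph K v).Reachable ⟨a₀, h₀⟩ ⟨a, ha⟩) (fun _ => .rfl) fun a b hab ih hb => by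
      obtain ⟨hva, -, hne⟩ := Finset.card_triple_eq_three_iff.1 (mem_triangles.1 hab).2
      have ha : (oneSkeleton K).Adj v a :=
        isEdge_pair_iff.1 (isEdge_of_subset hab (by grind) (Finset.card_pair hva))
      have hadj : (linkGraph K v).Adj ⟨a, ha⟩ ⟨b, hb⟩ :=
        ⟨fun e => hne (congrArg Subtype.val e), (mem_triangles.1 hab).1⟩
      exact (ih ha).trans hadj.reachable
  have : Nonempty {a // (oneSkeleton K).Adj v a} := ⟨⟨a₀, h₀⟩⟩
  exact ⟨fun a b => (hreach a.1 a.2 a.2).symm.trans (hreach b.1 b.2 b.2)⟩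

namespace Triangulation

variable {V : Type u} [Fintype V] [DecidableEq V] {T : Triangulation V} {x y : V}

theorem connected_contractCx (hxy : x ≠ y) : (oneSkeleton (T.contractCx hxy)).Connected := by
  have hreach : ∀ a b : V, (oneSkeleton (T.contractCx hxy)).Reachable (contractMap hxy a)
      (contractMap hxy b) := fun a => T.isDisk.connected_induction .rfl fun c d hcd hc => by
    by_cases he : contractMap hxy c = contractMap hxy d
    · exact he ▸ hc
    · exact hc.trans (adj_contractMap hxy hcd he).reachable
  have : Nonempty {u : V // u ≠ y} := ⟨⟨x, hxy⟩⟩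
  refine ⟨fun a b => ?_⟩
  rw [← contractMap_coe hxy a, ← contractMap_coe hxy b]
  exact hreach _ _

theorem linkGraph_contractCx_of_ne (hxy : x ≠ y) {v : {u : V // u ≠ y}} (hv : v.1 ≠ x) :
    (linkGraph (T.contractCx hxy) v).Connected := by
  have hlift : ∀ c, contractMap hxy c = v → c = v.1 := by
    intro c hc
    have := v.2
    rw [← contractMap_coe hxy v, contractMap_eq_iff] at hc
    grind only
  obtain ⟨a₀, h₀⟩ := T.isDisk.exists_adj v.1
  have h₀' := adj_contractMap hxy h₀ fun e => h₀.1 <| .symm <| hlift a₀ <|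
    e.symm.trans (contractMap_coe hxy v)
  rw [contractMap_coe] at h₀'
  refine linkGraph_connected_of_induction h₀' fun P hP step a ha => ?_
  obtain ⟨-, v', a, hadj, hv', rfl⟩ := (oneSkeleton_contractCx_adj_iff hxy).1 ha
  rw [hlift v' hv'] at hadj
  refine T.isDisk.link_induction (P := fun a => P (contractMap hxy a)) h₀ hP
    (fun a b hab ih => ?_) hadj
  by_cases hn : {x, y} ⊆ ({v.1, a, b} : Finset V)
  · exact contractMap_eq_of_subset hxy hv v.2 hn ▸ ih
  · have := triple_mem_triangles_contractCx hxy hab hn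
    rw [contractMap_coe] at this
    exact step _ _ this ih

namespace IsContractible

variable (h : T.IsContractible x y)

include h

theorem link_induction_right {P : {u : V // u ≠ y} → Prop} {z : V} (hz : T.pos y x z)
    (hP : P (contractMap h.adj.1 z))
    (step : ∀ a b, {⟨x, h.adj.1⟩, a, b} ∈ triangles (T.contractCx h.adj.1) → P a → P b) {c : V}
    (hc : (oneSkeleton T.cx).Adj y c) : c = x ∨ P (contractMap h.adj.1 c) := by
  have o := T.isOrientation
  refine cyclic_link_induction (P := fun c => c = x ∨ P (contractMap h.adj.1 c)) h.ne_corner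
    h.adj.symm (.inl rfl) (fun c d hcd ih => or_iff_not_imp_left.2 fun hd => ?_) hc
  rcases eq_or_ne c x with rfl | hc
  · exact o.coherent hcd hz ▸ hP
  · have hn : ¬ {x, y} ⊆ ({y, c, d} : Finset V) := fun hs =>
      absurd (hs (Finset.mem_insert_self x _)) (by simp [h.adj.1, hc.symm, Ne.symm hd])
    have := triple_mem_triangles_contractCx h.adj.1 (o.mem_triangles hcd) hn
    rw [contractMap_right] at this
    exact step _ _ this (ih.resolve_left hc)

theorem link_induction_left {P : {u : V // u ≠ y} → Prop} {z : V} (hz : T.pos y x z)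
    (hP : P (contractMap h.adj.1 z))
    (step : ∀ a b, {⟨x, h.adj.1⟩, a, b} ∈ triangles (T.contractCx h.adj.1) → P a → P b) {c : V}
    (hc : (oneSkeleton T.cx).Adj x c) : c = y ∨ P (contractMap h.adj.1 c) := by
  refine T.isDisk.link_induction (P := fun c => c = y ∨ P (contractMap h.adj.1 c)) h.adj
    (.inl rfl) (fun c d hcd ih => or_iff_not_imp_left.2 fun hd => ?_) hc
  obtain ⟨-, hxd, hne⟩ := Finset.card_triple_eq_three_iff.1 (mem_triangles.1 hcd).2
  rcases eq_or_ne c y with rfl | hc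
  · have hadj : (oneSkeleton T.cx).Adj c d :=
      isEdge_pair_iff.1 (isEdge_of_subset hcd (by grind) (Finset.card_pair hne))
    exact (h.link_induction_right hz hP step hadj).resolve_left hxd.symm
  · have hn : ¬ {x, y} ⊆ ({x, c, d} : Finset V) := fun hs =>
      absurd (hs (by simp : y ∈ _)) (by simp [h.adj.1.symm, hc.symm, Ne.symm hd])
    have := triple_mem_triangles_contractCx h.adj.1 hcd hn
    rw [contractMap_left] at this
    exact step _ _ this (ih.resolve_left hc)

theorem linkGraph_contractCx_self :
    (linkGraph (T.contractCx h.adj.1) ⟨x, h.adj.1⟩).Connected := by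
  obtain ⟨z, hz⟩ := (isDart_and_isDart_of_adj h.adj.symm h.ne_corner).1
  have hzx := T.isOrientation.ne_right hz
  have hzy := T.isOrientation.ne_outer hz
  have hadj := adj_contractMap h.adj.1 (T.isOrientation.adj_outer hz) (by
    rw [Ne, contractMap_eq_iff]
    grind only)
  rw [contractMap_right] at hadj
  refine linkGraph_connected_of_induction hadj fun P hP step a ha => ?_
  obtain ⟨hne, v, c, hvc, hv, rfl⟩ := (oneSkeleton_contractCx_adj_iff h.adj.1).1 ha
  have hc := mt (contractMap_eq_left_iff h.adj.1).2 hne.symm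
  rcases (contractMap_eq_left_iff h.adj.1).1 hv with rfl | rfl
  · exact (h.link_induction_left hz hP step hvc).resolve_left fun e => hc (.inr e)
  · exact (h.link_induction_right hz hP step hvc).resolve_left fun e => hc (.inl e)

theorem exists_ne_mem_triangles {z : V} (hz : (oneSkeleton T.cx).Adj y z) :
    ∃ w ≠ x, {y, z, w} ∈ triangles T.cx := by
  have o := T.isOrientation
  obtain ⟨⟨w, hw⟩, ⟨w', hw'⟩⟩ := isDart_and_isDart_of_adj hz h.ne_corner
  rcases eq_or_ne w x with rfl | hwx
  · refine ⟨w', ?_, Finset.insert_comm z y {w'} ▸ o.mem_triangles hw'⟩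
    rintro rfl
    exact o.asymm hw hw'
  · exact ⟨w, hwx, o.mem_triangles hw⟩

theorem pure_contractCx {s : Finset {u : V // u ≠ y}} (hs : s ∈ (T.contractCx h.adj.1).faces) :
    ∃ t ∈ triangles (T.contractCx h.adj.1), s ⊆ t := by
  obtain ⟨s, hs', rfl⟩ := (mem_contractCx h.adj.1).1 hs
  obtain ⟨t, ht, hst⟩ := T.isDisk.pure _ hs'
  suffices hsup : ∃ t' ∈ triangles T.cx, ¬ {x, y} ⊆ t' ∧
      t.image (contractMap h.adj.1) ⊆ t'.image (contractMap h.adj.1) by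
    obtain ⟨t', ht', hn, hsub⟩ := hsup
    exact ⟨_, (mem_triangles_contractCx h.adj.1).2 ⟨t', ht', hn, rfl⟩,
      (Finset.image_subset_image hst).trans hsub⟩
  by_cases hxyt : {x, y} ⊆ t
  · obtain ⟨z, -, rfl⟩ := T.isOrientation.exists_pos_of_pair ht h.adj.1 (hxyt (by simp))
      (hxyt (by simp))
    obtain ⟨-, hxz, hyz⟩ := Finset.card_triple_eq_three_iff.1 (mem_triangles.1 ht).2
    have hadj : (oneSkeleton T.cx).Adj y z :=
      isEdge_pair_iff.1 (isEdge_of_subset ht (by grind) (Finset.card_pair hyz))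
    obtain ⟨w, hw, ht'⟩ := h.exists_ne_mem_triangles hadj
    refine ⟨_, ht', fun hs => ?_, ?_⟩
    · exact absurd (hs (Finset.mem_insert_self x _)) (by simp [h.adj.1, hxz, hw.symm])
    · simp only [Finset.image_insert, Finset.image_singleton, contractMap_left, contractMap_right]
      grind
  · exact ⟨t, ht, hxyt, subset_rfl⟩

theorem pair_mem_of_contractMap_eq {a b : V}
    (hab : contractMap h.adj.1 a = contractMap h.adj.1 b) : {a, b} ∈ T.cx.faces := by
  rcases (contractMap_eq_iff h.adj.1).1 hab with rfl | ⟨rfl, rfl⟩ | ⟨rfl, rfl⟩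
  · simpa using T.cx.singleton_mem a
  · exact h.adj.2
  · exact h.adj.symm.2

/-- Consecutive edges of the path lift to edges whose ends differ at most by the edge `xy`, which
is therefore inserted where necessary. -/
theorem exists_lift_path (l : List {u : V // u ≠ y}) (a b : V)
    (hp : IsEdgePath (T.contractCx h.adj.1)
      (contractMap h.adj.1 a :: l ++ [contractMap h.adj.1 b])) :
    ∃ m : List V, IsEdgePath T.cx (a :: m ++ [b]) ∧
      Relation.EqvGen (ElementaryHomotopy (T.contractCx h.adj.1))
        ((a :: m ++ [b]).map (contractMap h.adj.1))
        (contractMap h.adj.1 a :: l ++ [contractMap h.adj.1 b]) := by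
  induction l generalizing a with
  | nil =>
    obtain ⟨hab, -⟩ := isEdgePath_cons_cons.1 hp
    obtain ⟨a₁, b₁, hf, ha, hb⟩ := (pair_mem_contractCx_iff h.adj.1).1 hab
    refine ⟨[a₁, b₁], isEdgePath_cons_cons.2 ⟨h.pair_mem_of_contractMap_eq ha.symm,
      isEdgePath_cons_cons.2 ⟨hf, isEdgePath_cons_cons.2
        ⟨h.pair_mem_of_contractMap_eq hb, .singleton _⟩⟩⟩, ?_⟩
    simp only [List.cons_append, List.nil_append, List.map_cons, List.map_nil, ha, hb]
    exact .trans _ [_, _, _] _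
      (.rel _ _ ⟨[], [contractMap h.adj.1 b], contractMap h.adj.1 a, contractMap h.adj.1 a,
        contractMap h.adj.1 b, by simpa using hab, rfl, rfl⟩)
      (.rel _ _ ⟨[], [], contractMap h.adj.1 a, contractMap h.adj.1 b, contractMap h.adj.1 b,
        by simpa using hab, rfl, rfl⟩)
  | cons c l ih =>
    obtain ⟨hac, hcl⟩ := isEdgePath_cons_cons.1 hp
    obtain ⟨a₁, c₁, hf, ha, rfl⟩ := (pair_mem_contractCx_iff h.adj.1).1 hac
    obtain ⟨m, hm, hhom⟩ := ih c₁ hcl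
    refine ⟨a₁ :: c₁ :: m, isEdgePath_cons_cons.2 ⟨h.pair_mem_of_contractMap_eq ha.symm,
      isEdgePath_cons_cons.2 ⟨hf, hm⟩⟩, ?_⟩
    simp only [List.cons_append, List.map_cons, ha] at hhom ⊢
    refine .trans _ _ _ (eqvGen_map (_ :: _ :: ·) (fun _ _ hm => .cons _ (.cons _ hm)) hhom) ?_
    exact .rel _ _ ⟨[], l ++ [contractMap h.adj.1 b], contractMap h.adj.1 a,
      contractMap h.adj.1 a, contractMap h.adj.1 c₁, by simpa using hac, rfl, rfl⟩

theorem isDisk_contractCx : IsDisk (T.contractCx h.adj.1) where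
  card_le s hs := by
    obtain ⟨s, hs', rfl⟩ := (mem_contractCx h.adj.1).1 hs
    exact Finset.card_image_le.trans (T.isDisk.card_le s hs')
  pure _ := h.pure_contractCx
  edge_card_le e he := by
    classical
    obtain ⟨a, b, hab, rfl⟩ := Finset.card_eq_two.1 he.2
    rw [h.isOrientation.card_trianglesAt_pair hab]
    split_ifs <;> omega
  link_connected v := by
    obtain ⟨v, hv⟩ := v
    rcases eq_or_ne v x with rfl | hvx
    · exact h.linkGraph_contractCx_self
    · exact linkGraph_contractCx_of_ne h.adj.1 hvx
  connected := connected_contractCx h.adj.1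
  simply_connected v l hl := by
    obtain ⟨m, hm, hhom⟩ := h.exists_lift_path l v.1 v.1 (by rwa [contractMap_coe])
    rw [contractMap_coe] at hhom
    have hmap := eqvGen_map (List.map (contractMap h.adj.1))
      (fun _ _ => ElementaryHomotopy.map fun s hs => (mem_contractCx h.adj.1).2 ⟨s, hs, rfl⟩)
      (T.isDisk.simply_connected v.1 m hm)
    simp only [List.map_cons, List.map_nil, contractMap_coe] at hmap
    exact hhom.symm.trans _ _ _ hmap
  boundary_nonempty := ⟨_, h.isBoundaryEdge_contractCx_iff_exists_corner.2 ⟨0, rfl⟩⟩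

/-- The triangulation obtained by contracting an edge. -/
def contract : Triangulation {u : V // u ≠ y} where
  toAbstractSimplicialComplex := T.contractCx h.adj.1
  isDisk := h.isDisk_contractCx
  pos := T.contractPos h.adj.1
  pos_triangle _ _ _ := h.isOrientation.mem_triangles
  pos_rotate _ _ _ := h.isOrientation.rotate
  pos_xor _ _ _ := h.isOrientation.xor
  pos_coherent _ _ _ _ := h.isOrientation.coherent
  corner := h.contractCorner
  corner_injective _ _ hij := T.corner_injective (congrArg Subtype.val hij)
  boundary_iff _ := h.isBoundaryEdge_contractCx_iff_exists_corner
  corner_pos i := h.isDart_contractPos_of_isDart (T.corner_pos i)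

end IsContractible
end Triangulation

namespace Drawing

open Triangulation

variable {V : Type u} [Fintype V] [DecidableEq V] {T : Triangulation V} {x y : V}
  (ρ : Drawing T) (h : T.IsContractible x y)

/-- The drawing induced on the triangulation obtained by contracting an elastic edge. -/
def contract : Drawing h.contract where
  toFun v := ρ.toFun v.1
  parallelogram := ρ.parallelogram

theorem contract_toFun (he : ρ.toFun x = ρ.toFun y) (v : V) :
    (ρ.contract h).toFun (contractMap h.adj.1 v) = ρ.toFun v := by
  change ρ.toFun (if v = y then x else v) = _
  split_ifs with hv
  · rw [hv, he]
  · rfl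

variable {ρ} in
theorem not_subset_of_mem_nondegenerate (hxy : x ≠ y) (he : ρ.toFun x = ρ.toFun y) {t : Finset V}
    (ht : t ∈ ρ.nondegenerate) : ¬ {x, y} ⊆ t := by
  intro hs
  obtain ⟨z, -, rfl⟩ := T.isOrientation.exists_pos_of_pair (ρ.nondegenerate_subset ht) hxy
    (hs (by simp)) (hs (by simp))
  exact (mem_nondegenerate.1 ht).2 (by rw [he, sub_self, zero_cross])

theorem image_mem_nondegenerate_contract_iff (he : ρ.toFun x = ρ.toFun y) {t : Finset V} :
    t.image (contractMap h.adj.1) ∈ (ρ.contract h).nondegenerate ↔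
      t.image (contractMap h.adj.1) ∈ triangles (T.contractCx h.adj.1) ∧
        ¬ Collinear ℂ (ρ.toFun '' (t : Set V)) := by
  classical
  rw [nondegenerate, Finset.mem_filter, Finset.coe_image, Set.image_image,
    Set.image_congr fun v _ => contract_toFun ρ h he v]
  rfl

theorem sameNondegenerate_contract (he : ρ.toFun x = ρ.toFun y) :
    ρ.SameNondegenerate (ρ.contract h) := by
  classical
  have hn {t : Finset V} (ht : t ∈ ρ.nondegenerate) : ¬ {x, y} ⊆ t :=
    not_subset_of_mem_nondegenerate h.adj.1 he ht
  refine ⟨contractMap h.adj.1, ⟨fun t ht => ?_, fun t ht t' ht' htt' => ?_, fun t' ht' => ?_⟩,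
    fun t _ v _ => contract_toFun ρ h he v, fun a b c hp ht => ?_⟩
  · exact (ρ.image_mem_nondegenerate_contract_iff h he).2
      ⟨(mem_triangles_contractCx _).2 ⟨t, ρ.nondegenerate_subset ht, hn ht, rfl⟩,
        (Finset.mem_filter.1 ht).2⟩
  · exact h.canContract.image_injOn h.adj.1 (ρ.nondegenerate_subset ht)
      (ρ.nondegenerate_subset ht') (hn ht) (hn ht') htt'
  · obtain ⟨t, ht, -, rfl⟩ :=
      (mem_triangles_contractCx _).1 ((ρ.contract h).nondegenerate_subset ht')
    exact ⟨t, Finset.mem_coe.2 (Finset.mem_filter.2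
      ⟨ht, ((ρ.image_mem_nondegenerate_contract_iff h he).1 ht').2⟩), rfl⟩
  · exact contractPos_of_pos h.adj.1 hp (hn ht)

end Drawing

/-! ### Reduction to simple drawings -/

namespace Drawing

open Triangulation

variable {V : Type u} [Fintype V] [DecidableEq V] {T : Triangulation V} {ρ ρ' : Drawing T}

theorem sameNondegenerate_of_eqOn (h : ρ'.nondegenerate = ρ.nondegenerate)
    (h' : ∀ t ∈ ρ.nondegenerate, ∀ v ∈ t, ρ'.toFun v = ρ.toFun v) : ρ.SameNondegenerate ρ' := by
  refine ⟨id, ?_, h', fun _ _ _ hp _ => hp⟩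
  simp only [Finset.image_id, h]
  exact Set.bijOn_id _

theorem SameNondegenerate.refl (ρ : Drawing T) : ρ.SameNondegenerate ρ :=
  sameNondegenerate_of_eqOn rfl fun _ _ _ _ => rfl

section Transfer

variable {V' V'' : Type u} [Fintype V'] [DecidableEq V'] [Fintype V''] [DecidableEq V'']
  {T' : Triangulation V'} {T'' : Triangulation V''} {σ : Drawing T'} {τ : Drawing T''}

theorem SameNondegenerate.trans (h : ρ.SameNondegenerate σ) (h' : σ.SameNondegenerate τ) :
    ρ.SameNondegenerate τ := by
  obtain ⟨f, hf, hf_toFun, hf_pos⟩ := h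
  obtain ⟨g, hg, hg_toFun, hg_pos⟩ := h'
  refine ⟨g ∘ f, ?_, fun t ht v hv => ?_, fun a b c hp ht => ?_⟩
  · simpa only [Function.comp_def, Finset.image_image] using hg.comp hf
  · rw [Function.comp_apply, hg_toFun _ (hf.mapsTo ht) _ (Finset.mem_image_of_mem f hv),
      hf_toFun t ht v hv]
  · refine hg_pos _ _ _ (hf_pos a b c hp ht) ?_
    simpa only [Finset.image_insert, Finset.image_singleton, Finset.mem_coe] using hf.mapsTo ht

theorem SameNondegenerate.nonempty (h : ρ.SameNondegenerate σ)
    (hne : ρ.nondegenerate.Nonempty) : σ.nondegenerate.Nonempty := by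
  obtain ⟨f, hf, -, -⟩ := h
  obtain ⟨t, ht⟩ := hne
  exact ⟨_, hf.mapsTo ht⟩

theorem area_image {f : V → V'} {t : Finset V} (ht : t ∈ ρ.nondegenerate)
    (htoFun : ∀ v ∈ t, σ.toFun (f v) = ρ.toFun v)
    (hpos : ∀ a b c, T.pos a b c → {a, b, c} ∈ ρ.nondegenerate → T'.pos (f a) (f b) (f c)) :
    σ.area (t.image f) = ρ.area t := by
  obtain ⟨a, b, c, hp, rfl⟩ := T.isOrientation.exists_pos (ρ.nondegenerate_subset ht)
  rw [Finset.image_insert, Finset.image_insert, Finset.image_singleton, area_eq ρ hp,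
    area_eq σ (hpos _ _ _ hp ht), htoFun a (by simp), htoFun b (by simp), htoFun c (by simp)]

theorem SameNondegenerate.noZeroSum (h : ρ.SameNondegenerate σ) (hρ : ρ.NoZeroSum) :
    σ.NoZeroSum := by
  obtain ⟨f, hf, htoFun, hpos⟩ := h
  intro S' hS' hne
  obtain ⟨S, hS, rfl⟩ : ∃ S ⊆ ρ.nondegenerate, S.image (fun t => t.image f) = S' :=
    Finset.subset_image_iff.1 fun t' ht' => by
      obtain ⟨t, ht, rfl⟩ := hf.surjOn (hS' ht')
      exact Finset.mem_image_of_mem _ ht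
  rw [Finset.sum_image fun t ht t' ht' he => hf.injOn (hS ht) (hS ht') he,
    Finset.sum_congr rfl fun t ht => area_image (hS ht) (htoFun t (hS ht)) hpos]
  exact hρ S hS (Finset.image_nonempty.1 hne)

end Transfer

/-- There is a drawing with the same nondegenerate triangles and fewer vertices. -/
def IsReducible (ρ : Drawing T) : Prop :=
  ∃ (V' : Type u) (_ : Fintype V') (_ : DecidableEq V') (T' : Triangulation V') (σ : Drawing T'),
    Fintype.card V' < Fintype.card V ∧ ρ.SameNondegenerate σ

theorem SameNondegenerate.isReducible (h : ρ.SameNondegenerate ρ') (h' : ρ'.IsReducible) :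
    ρ.IsReducible := by
  obtain ⟨V', _, _, T', σ, hcard, hσ⟩ := h'
  exact ⟨V', _, _, T', σ, hcard, h.trans hσ⟩

theorem isReducible_of_isContractible {x y : V} (h : T.IsContractible x y)
    (he : ρ.toFun x = ρ.toFun y) : ρ.IsReducible :=
  ⟨_, inferInstance, inferInstance, _, ρ.contract h,
    Fintype.card_subtype_lt (p := fun u => u ≠ y) (x := y) (by simp),
    ρ.sameNondegenerate_contract h he⟩

theorem NoZeroSum.toFun_corner_ne_add_two (hρ : ρ.NoZeroSum) (hne : ρ.nondegenerate.Nonempty)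
    (i : Fin 4) : ρ.toFun (T.corner i) ≠ ρ.toFun (T.corner (i + 2)) := by
  intro he
  have hsum := ρ.corner_add_corner i
  rw [← he] at hsum
  have hneg : ρ.toFun (T.corner (i + 3)) - ρ.toFun (T.corner i) =
      -(ρ.toFun (T.corner (i + 1)) - ρ.toFun (T.corner i)) := by
    rw [neg_sub, sub_eq_sub_iff_add_eq_add, hsum, add_comm]
  refine hρ.cross_corner_ne_zero hne i ?_
  rw [hneg]
  simpa only [one_smul, neg_smul] using
    cross_smul_smul 1 (-1) (ρ.toFun (T.corner (i + 1)) - ρ.toFun (T.corner i))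

theorem NoZeroSum.isReducible_of_canContract (hρ : ρ.NoZeroSum) (hne : ρ.nondegenerate.Nonempty)
    {x y : V} (hxy : IsInteriorEdge T.cx {x, y}) (he : ρ.toFun x = ρ.toFun y)
    (hc : T.CanContract x y) : ρ.IsReducible := by
  have hadj := isEdge_pair_iff.1 hxy.1
  obtain ⟨dart_xy, dart_yx⟩ := isInteriorEdge_iff.1 hxy
  by_cases hy : ∀ i, y ≠ T.corner i
  · exact isReducible_of_isContractible ⟨hadj, hy, hc⟩ he
  by_cases hx : ∀ i, x ≠ T.corner i
  · exact isReducible_of_isContractible ⟨hadj.symm, hx, hc.symm hadj⟩ he.symm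
  push Not at hx hy
  obtain ⟨i, rfl⟩ := hx
  obtain ⟨j, rfl⟩ := hy
  have corner_cases : ∀ i j : Fin 4, j = i ∨ j = i + 1 ∨ i = j + 1 ∨ j = i + 2 := by decide
  rcases corner_cases i j with rfl | rfl | rfl | rfl
  · exact absurd rfl hadj.1
  · exact absurd dart_yx (not_isDart_corner i)
  · exact absurd dart_xy (not_isDart_corner j)
  · exact absurd he (hρ.toFun_corner_ne_add_two hne i)

theorem cross_eq_zero_of_adj {v w a : V} (hdeg : ∀ t ∈ ρ.nondegenerate, v ∉ t)
    (hne : ∀ u, (oneSkeleton T.cx).Adj v u → ρ.toFun v ≠ ρ.toFun u)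
    (hw : (oneSkeleton T.cx).Adj v w) (ha : (oneSkeleton T.cx).Adj v a) :
    cross (ρ.toFun w - ρ.toFun v) (ρ.toFun a - ρ.toFun v) = 0 := by
  refine T.isDisk.link_induction
    (P := fun a => cross (ρ.toFun w - ρ.toFun v) (ρ.toFun a - ρ.toFun v) = 0) hw (cross_self _)
    (fun a b hab ih => ?_) ha
  have hva : (oneSkeleton T.cx).Adj v a := isEdge_pair_iff.1 <| isEdge_of_subset hab (by grind) <|
    Finset.card_pair (Finset.card_triple_eq_three_iff.1 (mem_triangles.1 hab).2).1
  exact cross_eq_zero_trans (sub_ne_zero.2 (hne a hva).symm) (cross_eq_zero_comm.1 ih)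
    (cross_eq_zero_of_notMem hab fun h => hdeg _ h (by simp))

/-- The drawing `ρ` with the vertex `v`, which is not a corner, moved to the point `P`. -/
def update (ρ : Drawing T) {v : V} (hv : ∀ i, v ≠ T.corner i) (P : Fin 2 → ℂ) : Drawing T where
  toFun := Function.update ρ.toFun v P
  parallelogram := by simpa [Function.update_of_ne (hv _).symm] using ρ.parallelogram

theorem update_self (ρ : Drawing T) {v : V} (hv : ∀ i, v ≠ T.corner i) (P : Fin 2 → ℂ) :
    (ρ.update hv P).toFun v = P :=
  Function.update_self ..

theorem update_of_ne (ρ : Drawing T) {u v : V} (hv : ∀ i, v ≠ T.corner i) (P : Fin 2 → ℂ)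
    (h : u ≠ v) : (ρ.update hv P).toFun u = ρ.toFun u :=
  Function.update_of_ne h ..

theorem mem_nondegenerate_update_iff {v : V} (hv : ∀ i, v ≠ T.corner i) (P : Fin 2 → ℂ)
    {t : Finset V} (hvt : v ∉ t) : t ∈ (ρ.update hv P).nondegenerate ↔ t ∈ ρ.nondegenerate := by
  classical
  have himage : (ρ.update hv P).toFun '' (t : Set V) = ρ.toFun '' (t : Set V) :=
    Set.image_congr fun u hu => ρ.update_of_ne hv P (ne_of_mem_of_not_mem hu hvt)
  simp only [nondegenerate, Finset.mem_filter, himage]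

theorem nondegenerate_update {v w : V} (hv : ∀ i, v ≠ T.corner i)
    (hdeg : ∀ t ∈ ρ.nondegenerate, v ∉ t)
    (hne : ∀ u, (oneSkeleton T.cx).Adj v u → ρ.toFun v ≠ ρ.toFun u)
    (hw : (oneSkeleton T.cx).Adj v w) :
    (ρ.update hv (ρ.toFun w)).nondegenerate = ρ.nondegenerate := by
  ext t
  by_cases hvt : v ∈ t
  · refine iff_of_false (fun ht => ?_) fun ht => hdeg t ht hvt
    have o := T.isOrientation
    obtain ⟨a, b, hp, rfl⟩ := o.exists_pos_of_mem (nondegenerate_subset _ ht) hvt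
    refine (mem_nondegenerate.1 ht).2 ?_
    rw [update_self, ρ.update_of_ne hv _ (o.ne_left hp).symm,
      ρ.update_of_ne hv _ (o.ne_outer hp).symm]
    have hwa := cross_eq_zero_of_adj hdeg hne hw (o.adj_left hp)
    have hwb := cross_eq_zero_of_adj hdeg hne hw (o.adj_outer hp)
    have hab := cross_eq_zero_of_notMem (T.pos_triangle _ _ _ hp) fun h => hdeg _ h hvt
    simp only [cross, Pi.sub_apply] at hwa hwb hab ⊢
    linear_combination hab - hwb + hwa
  · exact mem_nondegenerate_update_iff hv _ hvt

theorem exists_sameNondegenerate_toFun_eq (ρ : Drawing T) {v : V} (hv : ∀ i, v ≠ T.corner i)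
    (hdeg : ∀ t ∈ ρ.nondegenerate, v ∉ t) : ∃ ρ' : Drawing T, ρ.SameNondegenerate ρ' ∧
      ∃ w, (oneSkeleton T.cx).Adj v w ∧ ρ'.toFun v = ρ'.toFun w := by
  by_cases! hne : ∃ w, (oneSkeleton T.cx).Adj v w ∧ ρ.toFun v = ρ.toFun w
  · exact ⟨ρ, .refl ρ, hne⟩
  obtain ⟨w, hw⟩ := T.isDisk.exists_adj v
  refine ⟨ρ.update hv (ρ.toFun w),
    sameNondegenerate_of_eqOn (nondegenerate_update hv hdeg hne hw) fun t ht u hu => ?_, w, hw, ?_⟩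
  · exact ρ.update_of_ne hv _ (ne_of_mem_of_not_mem hu (hdeg t ht))
  · rw [update_self, update_of_ne _ _ _ hw.1.symm]

/-- A vertex inside the 3-cycle can be moved to a neighbour `w`. Either the edge `vw` can be
contracted, or it lies on a 3-cycle `vwz` with smaller inside. -/
theorem NoZeroSum.isReducible_of_isSubdivision (hρ : ρ.NoZeroSum)
    (hne : ρ.nondegenerate.Nonempty) {S : Finset V} (hS : T.IsSubdivision S)
    (hin : ∀ t ∈ ρ.nondegenerate, ¬ T.IsInside S t) : ρ.IsReducible := by
  induction hn : {t | T.IsInside S t}.ncard using Nat.strong_induction_on generalizing S with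
  | _ n ih =>
    obtain ⟨t, v, ht, hvt, hvS⟩ := hS.exists_isInside_notMem
    have hv := mem_interiorVertices.1 (ht.mem_interiorVertices hvS hvt)
    obtain ⟨ρ', hsame, w, hw, he⟩ := ρ.exists_sameNondegenerate_toFun_eq hv fun s hs hvs =>
      hin s hs (ht.of_mem hvS hvt (ρ.nondegenerate_subset hs) hvs)
    by_cases hc : T.CanContract v w
    · exact hsame.isReducible <| (hsame.noZeroSum hρ).isReducible_of_canContract
        (hsame.nonempty hne) (isInteriorEdge_iff.2 (isDart_and_isDart_of_adj hw hv)) he hc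
    · obtain ⟨z, hz⟩ := exists_isSubdivision_of_not_canContract hw hc
      have hlt := ht.ssubset hvS hvt hz
      exact ih _ (hn ▸ Set.ncard_lt_ncard hlt (Set.toFinite _)) hz
        (fun s hs h => hin s hs (hlt.subset h)) rfl

theorem NoZeroSum.isReducible_of_toFun_eq (hρ : ρ.NoZeroSum) (hne : ρ.nondegenerate.Nonempty)
    {x y : V} (hxy : IsInteriorEdge T.cx {x, y}) (he : ρ.toFun x = ρ.toFun y) :
    ρ.IsReducible := by
  by_cases hc : T.CanContract x y
  · exact hρ.isReducible_of_canContract hne hxy he hc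
  · obtain ⟨z, hz⟩ := exists_isSubdivision_of_not_canContract (isEdge_pair_iff.1 hxy.1) hc
    exact hρ.isReducible_of_isSubdivision hne hz fun t ht => hρ.not_isInside he ht

theorem NoZeroSum.isReducible_of_forall_notMem (hρ : ρ.NoZeroSum)
    (hne : ρ.nondegenerate.Nonempty) {v : V} (hv : ∀ i, v ≠ T.corner i)
    (hdeg : ∀ t ∈ ρ.nondegenerate, v ∉ t) : ρ.IsReducible := by
  obtain ⟨ρ', hsame, w, hw, he⟩ := ρ.exists_sameNondegenerate_toFun_eq hv hdeg
  exact hsame.isReducible <| (hsame.noZeroSum hρ).isReducible_of_toFun_eq (hsame.nonempty hne)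
    (isInteriorEdge_iff.2 (isDart_and_isDart_of_adj hw hv)) he

theorem NoZeroSum.isSimple_or_isReducible (hρ : ρ.NoZeroSum) (hne : ρ.nondegenerate.Nonempty) :
    ρ.IsSimple ∨ ρ.IsReducible := by
  by_contra! ⟨hns, hred⟩
  refine hns ⟨fun S hS => ?_, ?_, fun v hv => ?_⟩
  · by_contra! hin
    exact hred (hρ.isReducible_of_isSubdivision hne hS hin)
  · rintro ⟨v, w, hvw, he, -⟩
    exact hred (hρ.isReducible_of_toFun_eq hne hvw he)
  · by_contra! hdeg
    exact hred (hρ.isReducible_of_forall_notMem hne (mem_interiorVertices.1 hv) hdeg)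

theorem NoZeroSum.exists_isSimple {V : Type u} [Fintype V] [DecidableEq V] {T : Triangulation V}
    {ρ : Drawing T} (hρ : ρ.NoZeroSum) (hne : ρ.nondegenerate.Nonempty) :
    ∃ (V' : Type u) (_ : Fintype V') (_ : DecidableEq V') (T' : Triangulation V')
      (σ : Drawing T'), σ.IsSimple ∧ ρ.SameNondegenerate σ := by
  induction hn : Fintype.card V using Nat.strong_induction_on generalizing V with
  | _ n ih =>
    rcases hρ.isSimple_or_isReducible hne with hs | ⟨V₁, _, _, T₁, σ, hlt, hsame⟩
    · exact ⟨V, _, _, T, ρ, hs, .refl ρ⟩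
    · obtain ⟨V', _, _, T', τ, hs, hsame'⟩ :=
        ih _ (hn ▸ hlt) (hsame.noZeroSum hρ) (hsame.nonempty hne) rfl
      exact ⟨V', _, _, T', τ, hs, hsame.trans hsame'⟩

end Drawing

end SquareDrawing

theorem mainTheorem8 :
    (∀ (V : Type u) [Fintype V] [DecidableEq V] (T : SquareDrawing.Triangulation V)
      (ρ : SquareDrawing.Drawing T),
      0 < ρ.nondegenerate.card → ρ.NoZeroSum →
      ∃ (V' : Type u) (_ : Fintype V') (_ : DecidableEq V') (T' : SquareDrawing.Triangulation V')
        (ρ' : SquareDrawing.Drawing T'), ρ'.IsSimple ∧ ρ.SameNondegenerate ρ') ∧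
    (∀ (V : Type u) [Fintype V] [DecidableEq V] (T : SquareDrawing.Triangulation V)
      (ρ : SquareDrawing.Drawing T) (l : ℕ),
      ρ.IsSimple → ρ.nondegenerate.card = l → 0 < l → ρ.NoZeroSum →
      (T.interiorVertices.card : ℚ) ≤ 3 / 2 * (l : ℚ) - 2 ∧
      ((SquareDrawing.triangles T.cx).card : ℚ) ≤ 3 * (l : ℚ) - 2) := by
  refine ⟨fun V _ _ T ρ hl hρ => hρ.exists_isSimple (Finset.card_pos.1 hl), ?_⟩
  rintro V _ _ T ρ l hs rfl hl hρ
  have hinterior : (2 * T.interiorVertices.card + 4 : ℚ) ≤ 3 * ρ.nondegenerate.card := by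
    exact_mod_cast hs.two_mul_card_interiorVertices_add_four_le hρ (Finset.card_pos.1 hl)
  have htri : ((SquareDrawing.triangles T.cx).card : ℚ) = 2 * T.interiorVertices.card + 2 := by
    exact_mod_cast T.card_triangles
  constructor <;> linarith
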